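/- **Convergence of the normalized torsion flow on homogeneous contact $3$-manifolds.** Let $M$ be a nonempty smooth $3$-manifold with smooth $1$-forms $\omega^1,\omega^2,\omega^3$ that form a basis of $T^*M$ at every point and satisfy $d\omega^i=\sum_{j<k}c^i_{jk}\,\omega^j\wedge\omega^k$ with constants $c^i_{jk}$, such that $\theta=\omega^1$ is a contact form and the basis is normalized: $c^1_{23}=1$ and $c^1_{12}=c^1_{13}=c^2_{12}=c^3_{13}=0$. Let $X_1,X_2,X_3$ be the dual frame, and for $a\in\mathbb R$, $c>0$ let $$J_{a,1,c}=aX_2\otimes\omega^2+cX_3\otimes\omega^2-\tfrac{1+a^2}{c}X_2\otimes\omega^3-aX_3\otimes\omega^3 ,$$ a complex structure on $\ker\theta$ compatible with $d\theta$. For a pseudohermitian structure $(J,\theta)$ on a $3$-manifold take local $(1,0)$-forms $\theta^1$ that vanish on the Reeb field and satisfy $d\theta=i\,\theta^1\wedge\theta^{\bar 1}$. The Tanaka–Webster connection form $\omega_1{}^1$ and the torsion coefficient $A^1{}_{\bar 1}$ are determined by $d\theta^1=\theta^1\wedge\omega_1{}^1+A^1{}_{\bar1}\,\theta\wedge\theta^{\bar1}$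 and $\omega_1{}^1+\overline{\omega_1{}^1}=0$. With $Z_1$ dual to $\theta^1$, the torsion tensor is $A_{J,\theta}=A^1{}_{\bar 1}Z_1\otimes\theta^{\bar1}+\overline{A^1{}_{\bar 1}}\,Z_{\bar1}\otimes\theta^{1}$, and the Webster curvature $W$ is given by $d\omega_1{}^1\equiv W\,\theta^1\wedge\theta^{\bar1}$ modulo $\theta$. The normalized torsion flow is $$\partial_tJ_{t}=2A_{J_t,\theta_t},\qquad \partial_t\theta_t=-2(W-\overline W)\theta_t ,$$ where $\overline W$ is the mean of $W$ with respect to the volume form $\theta\wedge d\theta$ (if the total volume is infinite, $\overline W=W$ when $W$ is constant). A homogeneous solution is a solution of the form $\theta_t=\theta$, $J_t=J_{a_t,1,c_t}$ with $c_t>0$. Fix $a_0\in\mathbb R$ and $c_0>0$, and consider homogeneous solutions starting at $J_{a_0,1,c_0}$. Put $c_\infty=\sqrt{-c^3_{12}/c^2_{13}}$. * (A) Suppose $c^3_{12}>0$ and $c^2_{13}<0$. Then $J_{a,1,c}$ (with $c>0$) has vanishing torsion if and only if $a=0$ and $c=c_\infty$. The homogeneous solution exists for all $t\ge0$, is unique,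 and converges to this torsion-free structure: $a_t\to0$, $c_t\to c_\infty$ and $J_t\to J_{0,1,c_\infty}$ as $t\to\infty$. * (R) Suppose $c^3_{12}<0$ and $c^2_{13}>0$. If $(a_0,c_0)\ne(0,c_\infty)$, there is a unique maximal homogeneous solution; it is defined on $[0,T)$ with $0<T<\infty$, it blows up at $T$, that is, $|a_t|+|c_t|+(1+a_t^2)/c_t\to\infty$ as $t\to T^-$, and $J_t$ does not converge as $t\to T^-$. If $(a_0,c_0)=(0,c_\infty)$, the torsion of $J_{a_0,1,c_0}$ vanishes, and the constant family is the unique homogeneous solution, defined for all $t\ge 0$. -/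

import Mathlib

open Set Filter Topology MeasureTheory
open scoped Manifold ContDiff

noncomputable section

namespace TorsionFlow

/-- The model space of a `3`-manifold. -/
abbrev E3 := EuclideanSpace ℝ (Fin 3)

section Forms

variable {M : Type*} [TopologicalSpace M] [ChartedSpace E3 M]
variable {F : Type*} [NormedAddCommGroup F] [NormedSpace ℝ F]

/-- `F`-valued `1`-forms on `M` (`F = ℝ` or `F = ℂ`), not necessarily smooth. -/
abbrev OneForm (M : Type*) [TopologicalSpace M] [ChartedSpace E3 M]
    (F : Type*) [NormedAddCommGroup F] [NormedSpace ℝ F] :=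
  (x : M) → TangentSpace (𝓡 3) x →L[ℝ] F

/-- Vector fields on `M`, not necessarily smooth. -/
abbrev VField (M : Type*) [TopologicalSpace M] [ChartedSpace E3 M] :=
  (x : M) → TangentSpace (𝓡 3) x

/-- Fields of endomorphisms of the tangent bundle. -/
abbrev EndField (M : Type*) [TopologicalSpace M] [ChartedSpace E3 M] :=
  (x : M) → TangentSpace (𝓡 3) x →L[ℝ] TangentSpace (𝓡 3) x

/-- The differential at `x` of a chart `e`. -/
def chartD (e : OpenPartialHomeomorph M E3) (x : M) : TangentSpace (𝓡 3) x →L[ℝ] E3 :=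
  mfderiv (𝓡 3) (𝓡 3) e x

/-- The differential at `y` of the inverse of a chart `e`. -/
def chartSymmD (e : OpenPartialHomeomorph M E3) (y : E3) :
    E3 →L[ℝ] TangentSpace (𝓡 3) (e.symm y) :=
  mfderiv (𝓡 3) (𝓡 3) e.symm y

/-- The pullback of a `1`-form by the inverse of the preferred chart at `x`;
only its values on the chart's target are meaningful. -/
def chartPullback (η : OneForm M F) (x : M) (y : E3) : E3 →L[ℝ] F :=
  (η ((chartAt E3 x).symm y)).comp (chartSymmD (chartAt E3 x) y)

/-- Smoothness of a `1`-form at every point of `U`, in the preferred charts. -/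
def SmoothFormOn (η : OneForm M F) (U : Set M) : Prop :=
  ∀ x ∈ U, ContDiffAt ℝ ∞ (chartPullback η x) (chartAt E3 x x)

/-- The exterior derivative of a `1`-form: pull back to the chart at `x`, take Mathlib's exterior
derivative there, and pull the result back to `M`.
The convention is `dη(V, W) = V(η(W)) - W(η(V)) - η([V, W])`. -/
def dForm (η : OneForm M F) (x : M) (v w : TangentSpace (𝓡 3) x) : F :=
  extDeriv (fun y => ContinuousAlternatingMap.ofSubsingleton ℝ E3 F (0 : Fin 1)
      (chartPullback η x y)) (chartAt E3 x x)
    ![chartD (chartAt E3 x) x v, chartD (chartAt E3 x) x w]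

/-- The value `(θ ∧ dθ)(u, v, w)` at `x`. -/
def contactVolume (θ : OneForm M ℝ) (x : M) (u v w : TangentSpace (𝓡 3) x) : ℝ :=
  θ x u * dForm θ x v w + θ x v * dForm θ x w u + θ x w * dForm θ x u v

/-- `θ` is a (smooth) contact form: `θ ∧ dθ` vanishes nowhere. -/
def IsContactForm (θ : OneForm M ℝ) : Prop :=
  SmoothFormOn θ univ ∧ ∀ x, ∃ u v w, contactVolume θ x u v w ≠ 0

/-- The measure on `M` defined by the volume form `θ ∧ dθ`, i.e. the smallest measure that
dominates, for each chart of the atlas, the measure on the chart domain that has density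
`|(θ ∧ dθ)(∂₁, ∂₂, ∂₃)|` with respect to Lebesgue measure in that chart. -/
def contactMeasure [MeasurableSpace M] (θ : OneForm M ℝ) : Measure M :=
  ⨆ e ∈ atlas E3 M, Measure.map e.symm
    ((volume.restrict e.target).withDensity fun y => ENNReal.ofReal
      |contactVolume θ (e.symm y)
        (chartSymmD e y (EuclideanSpace.single 0 1))
        (chartSymmD e y (EuclideanSpace.single 1 1))
        (chartSymmD e y (EuclideanSpace.single 2 1))|)

end Forms

section MeanValue

variable {M : Type*} [MeasurableSpace M]

/-- `m` is the mean value of `f`. If `μ` is finite and nonzero and `f` is integrable, this says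
`m = (∫ f dμ) / (∫ 1 dμ)`; if `μ` has infinite mass, then a constant function still has its
value as its only mean value. -/
def IsMeanValue (μ : Measure M) (f : M → ℝ) (m : ℝ) : Prop :=
  Integrable (fun x => f x - m) μ ∧ ∫ x, (f x - m) ∂μ = 0

end MeanValue

section Pseudohermitian

variable {M : Type*} [TopologicalSpace M] [ChartedSpace E3 M]

/-- `(M, θ, J)` is a strictly pseudoconvex pseudohermitian `3`-manifold: `θ` is a contact form and
`J` is a complex structure on `ξ = ker θ` such that `dθ(·, J ·)` is a metric on `ξ`. As usual, `J`
is extended to `TM` by `0` on the Reeb direction (the kernel of `dθ`). In dimension three the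
integrability condition is vacuous; smoothness of `J` is the existence of the smooth local
coframes of `IsTanakaWebster`. -/
structure IsPseudohermitian (θ : OneForm M ℝ) (J : EndField M) : Prop where
  contact : IsContactForm θ
  range_le : ∀ x v, θ x (J x v) = 0
  sq : ∀ x v, θ x v = 0 → J x (J x v) = -v
  reeb : ∀ x v, (∀ w, dForm θ x v w = 0) → J x v = 0
  symm : ∀ x v w, θ x v = 0 → θ x w = 0 → dForm θ x v (J x w) = dForm θ x w (J x v)
  pos : ∀ x v, θ x v = 0 → v ≠ 0 → 0 < dForm θ x v (J x v)

/-- On the set `U`, `θ1 = θ¹` is an admissible coframe of `(θ, J)`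
(a form of type `(1,0)` that vanishes on the Reeb field, with `dθ = i θ¹ ∧ θ̄¹`),
`conn = ω₁¹` is the Tanaka–Webster connection form
and `τ¹ = A θ̄¹` is the pseudohermitian torsion:
`dθ¹ = θ¹ ∧ ω₁¹ + θ ∧ τ¹` and `ω₁¹ + conj ω₁¹ = 0`. -/
structure IsTanakaWebster (θ : OneForm M ℝ) (J : EndField M) (U : Set M)
    (θ1 conn : OneForm M ℂ) (A : M → ℂ) : Prop where
  smooth_coframe : SmoothFormOn θ1 U
  smooth_conn : SmoothFormOn conn U
  type10 : ∀ x ∈ U, ∀ v, θ1 x (J x v) = Complex.I * θ1 x v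
  reeb : ∀ x ∈ U, ∀ v, (∀ w, dForm θ x v w = 0) → θ1 x v = 0
  normalized : ∀ x ∈ U, ∀ v w, ((dForm θ x v w : ℝ) : ℂ) =
    Complex.I * (θ1 x v * star (θ1 x w) - θ1 x w * star (θ1 x v))
  structure_eq : ∀ x ∈ U, ∀ v w, dForm θ1 x v w =
    (θ1 x v * conn x w - θ1 x w * conn x v) +
    ((θ x v : ℂ) * (A x * star (θ1 x w)) - (θ x w : ℂ) * (A x * star (θ1 x v)))
  skew : ∀ x ∈ U, ∀ v, conn x v + star (conn x v) = 0

/-- `S` is the torsion tensor `A¹_{1̄} Z₁ ⊗ θ̄¹ + A^{1̄}₁ Z̄₁ ⊗ θ¹` of `(θ, J)`, where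
`A¹_{1̄}` is the coefficient of the pseudohermitian torsion. On real vectors this is the
endomorphism with `θ(S v) = 0` and `θ¹(S v) = A¹_{1̄} θ̄¹(v)`. -/
def IsTorsionTensor (θ : OneForm M ℝ) (J S : EndField M) : Prop :=
  ∀ x, ∃ U : Set M, IsOpen U ∧ x ∈ U ∧ ∃ (θ1 conn : OneForm M ℂ) (A : M → ℂ),
    IsTanakaWebster θ J U θ1 conn A ∧
    ∀ v, θ x (S x v) = 0 ∧ θ1 x (S x v) = A x * star (θ1 x v)

/-- `W` is the Webster curvature of `(θ, J)`: `dω₁¹ = W θ¹ ∧ θ̄¹` modulo `θ`. -/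
def IsWebsterCurvature (θ : OneForm M ℝ) (J : EndField M) (W : M → ℝ) : Prop :=
  ∀ x, ∃ U : Set M, IsOpen U ∧ x ∈ U ∧ ∃ (θ1 conn : OneForm M ℂ) (A : M → ℂ),
    IsTanakaWebster θ J U θ1 conn A ∧
    ∀ v w, θ x v = 0 → θ x w = 0 →
      dForm conn x v w = (W x : ℂ) * (θ1 x v * star (θ1 x w) - θ1 x w * star (θ1 x v))

/-- `(J_t, θ_t)`, `t ∈ I`, solves the normalized torsion flow
`∂ₜ J = 2 A_{J,θ}`, `∂ₜ θ = -2 (W - W̄) θ`, where `W̄` is the mean value of the Webster curvature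
`W` with respect to the volume form `θ ∧ dθ`. Derivatives at an end point of the time interval
`I` are one-sided. -/
def IsNormalizedTorsionFlow [MeasurableSpace M]
    (θ : ℝ → OneForm M ℝ) (J : ℝ → EndField M) (I : Set ℝ) : Prop :=
  ∀ t ∈ I, IsPseudohermitian (θ t) (J t) ∧
    ∃ (S : EndField M) (W : M → ℝ) (Wmean : ℝ),
      IsTorsionTensor (θ t) (J t) S ∧ IsWebsterCurvature (θ t) (J t) W ∧
      IsMeanValue (contactMeasure (θ t)) W Wmean ∧
      (∀ x v, HasDerivWithinAt (fun s => J s x v) ((2 : ℝ) • S x v) I t) ∧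
      (∀ x v, HasDerivWithinAt (fun s => θ s x v) (-2 * (W x - Wmean) * θ t x v) I t)

end Pseudohermitian

section Homogeneous

variable {M : Type*} [TopologicalSpace M] [ChartedSpace E3 M]

/-- `(M, {σⁱ}, θ)` is a homogeneous contact manifold with dual frame `X` and structure
coefficients `C i j k = cⁱ_{jk}` (`j < k`); the index set `{1, 2, 3}` is `Fin 3 = {0, 1, 2}` here,
so that `C 2 0 1` is `c³₁₂`. That the `σⁱ` form a basis of `T*M` is expressed by the existence of
the dual frame, which they determine. -/
structure IsHomogeneousContact (σ : Fin 3 → OneForm M ℝ) (X : Fin 3 → VField M)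
    (C : Fin 3 → Fin 3 → Fin 3 → ℝ) (θ : OneForm M ℝ) : Prop where
  smooth : ∀ i, SmoothFormOn (σ i) univ
  dual : ∀ x i j, σ i x (X j x) = if i = j then 1 else 0
  structure_eq : ∀ i x v w, dForm (σ i) x v w =
    ∑ j, ∑ k ∈ Finset.Ioi j, C i j k * (σ j x v * σ k x w - σ j x w * σ k x v)
  contact : IsContactForm θ
  combination : ∃ r : Fin 3 → ℝ, ∀ x, θ x = ∑ i, r i • σ i x

/-- The conditions on the structure coefficients of a normalized basis:
`c¹₂₃ = 1` and `c¹₁₂ = c¹₁₃ = c²₁₂ = c³₁₃ = 0`. -/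
structure IsNormalizedBasis (C : Fin 3 → Fin 3 → Fin 3 → ℝ) : Prop where
  c123 : C 0 1 2 = 1
  c112 : C 0 0 1 = 0
  c113 : C 0 0 2 = 0
  c212 : C 1 0 1 = 0
  c313 : C 2 0 2 = 0

/-- The homogeneous complex structure
`J_{a,1,c} = a X₂ ⊗ σ² + c X₃ ⊗ σ² - (1 + a²)/c X₂ ⊗ σ³ - a X₃ ⊗ σ³`. -/
def homJ (σ : Fin 3 → OneForm M ℝ) (X : Fin 3 → VField M) (a c : ℝ) : EndField M :=
  fun x => (σ 1 x).smulRight (a • X 1 x + c • X 2 x) -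
    (σ 2 x).smulRight (((1 + a ^ 2) / c) • X 1 x + a • X 2 x)

/-- `t ↦ (θ = σ¹, J_{a(t),1,c(t)})`, with `c(t) > 0`, solves the normalized torsion flow on the
time interval `I` (which contains `0`), and starts at `J_{a₀,1,c₀}`. -/
structure IsHomogeneousFlow [MeasurableSpace M]
    (σ : Fin 3 → OneForm M ℝ) (X : Fin 3 → VField M) (a₀ c₀ : ℝ)
    (a c : ℝ → ℝ) (I : Set ℝ) : Prop where
  pos : ∀ t ∈ I, 0 < c t
  initial : a 0 = a₀ ∧ c 0 = c₀
  flow : IsNormalizedTorsionFlow (fun _ => σ 0) (fun t => homJ σ X (a t) (c t)) I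

/-- `J_{a,1,c}` has vanishing torsion with respect to `θ = σ¹`. -/
def IsTorsionFree (σ : Fin 3 → OneForm M ℝ) (X : Fin 3 → VField M) (a c : ℝ) : Prop :=
  IsTorsionTensor (σ 0) (homJ σ X a c) (fun _ => 0)

end Homogeneous

end TorsionFlow

end

/-! Write `p` for `C 1 0 2`, `q` for `C 2 0 1`, b = (1 + a²)/c and u = pc - qb. Every admissible
coframe of J_{a,1,c} is a function times σ² + zσ³ with z = (i - a)/c, and the first structure
equation then determines the torsion algebraically (`IsTanakaWebster.torsion_eq`). A coframe with
constant coefficients shows that a Tanaka–Webster structure exists and that W is constant, so θ does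
not move. The flow thus becomes the system a' = au, c' = cu + 2q, whence b' = bu - 2p.

Consequently u' = u² - k² with k² = -4pq > 0. The solution φ of φ' = -uφ, φ(0) = 1, satisfies φ'' =
k²φ, so φ = cosh kt - (u₀/k) sinh kt. With Φ the integral of φ from 0, the system integrates to a =
a₀/φ and c = (c₀ + 2qΦ)/φ (`IsCoefficientSolution.mul_riccatiDenom`, with converse
`isCoefficientSolution_div_riccatiDenom`); this also gives uniqueness while φ > 0.

If p < 0 < q, then u₀ < 0, φ grows like exp(kt), and a → 0, c → 2q/k = c_∞. If q < 0 < p, then u₀² -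
k² = (pc₀ + qb₀)² + k²a₀², so u₀ > k except at the fixed point (`lt_growthRate`). Then φ has a first
positive zero, at which u and with it J blow up. At the fixed point u₀ = k and φ = exp(-kt) never
vanishes. -/

namespace TorsionFlow

/-! ### Exterior derivatives in charts: constant-coefficient combinations and the Leibniz rule. -/

section FormCalculus

variable {M : Type*} [TopologicalSpace M] [ChartedSpace E3 M]
variable {F : Type*} [NormedAddCommGroup F] [NormedSpace ℝ F]

theorem chartPullback_chartD [IsManifold (𝓡 3) ∞ M] (η : OneForm M F) (x : M)
    (v : TangentSpace (𝓡 3) x) :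
    chartPullback η x (chartAt E3 x x) (chartD (chartAt E3 x) x v) = η x v := by
  have : IsManifold (𝓡 3) 1 M := IsManifold.of_le (n := ∞) (by simp)
  have h1 := (mdifferentiable_chart (I := 𝓡 3) x).symm_comp_deriv (mem_chart_source E3 x)
  have h2 : chartSymmD (chartAt E3 x) (chartAt E3 x x) (chartD (chartAt E3 x) x v) = v :=
    DFunLike.congr_fun h1 v
  -- The two base points are equal but not definitionally so; both forms are compared as maps on the
  -- common model space.
  have h3 : ∀ x' : M, x' = x → ∀ w : E3,
      (show E3 →L[ℝ] F from η x') w = (show E3 →L[ℝ] F from η x) w := by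
    rintro _ rfl w; rfl
  have h4 := h3 _ ((chartAt E3 x).left_inv (mem_chart_source E3 x))
    (chartSymmD (chartAt E3 x) (chartAt E3 x x) (chartD (chartAt E3 x) x v))
  refine h4.trans ?_
  exact congrArg (η x) h2

theorem SmoothFormOn.differentiableAt {η : OneForm M F} {U : Set M} (h : SmoothFormOn η U) {x : M}
    (hx : x ∈ U) : DifferentiableAt ℝ (chartPullback η x) (chartAt E3 x x) :=
  (h x hx).differentiableAt (by simp)

theorem dForm_eq_fderiv {η : OneForm M F} {x : M}
    (h : DifferentiableAt ℝ (chartPullback η x) (chartAt E3 x x)) (v w : TangentSpace (𝓡 3) x) :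
    dForm η x v w =
      fderiv ℝ (chartPullback η x) (chartAt E3 x x) (chartD (chartAt E3 x) x v)
        (chartD (chartAt E3 x) x w) -
      fderiv ℝ (chartPullback η x) (chartAt E3 x x) (chartD (chartAt E3 x) x w)
        (chartD (chartAt E3 x) x v) := by
  have hω : DifferentiableAt ℝ (fun y => ContinuousAlternatingMap.ofSubsingleton ℝ E3 F (0 : Fin 1)
      (chartPullback η x y)) (chartAt E3 x x) :=
    ((ContinuousAlternatingMap.ofSubsingletonLIE (𝕜 := ℝ) (E := E3) (F := F)
      (0 : Fin 1)).toContinuousLinearEquiv.differentiableAt).comp _ h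
  have key : ∀ V : E3, fderiv ℝ (fun y => chartPullback η x y V) (chartAt E3 x x) =
      (fderiv ℝ (chartPullback η x) (chartAt E3 x x)).flip V := fun V => by
    ext W
    rw [fderiv_clm_apply h (differentiableAt_const V)]
    simp
  unfold dForm
  rw [extDeriv_apply hω]
  simp [Fin.sum_univ_two, Fin.removeNth, key, sub_eq_add_neg]

/-- The complex-valued `1`-form `∑ r i • σ i`. -/
noncomputable def complexCombination (σ : Fin 3 → OneForm M ℝ) (r : Fin 3 → ℂ) : OneForm M ℂ :=
  fun x => ∑ i, (σ i x).smulRight (r i)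

@[simp]
theorem complexCombination_apply (σ : Fin 3 → OneForm M ℝ) (r : Fin 3 → ℂ) (x : M)
    (v : TangentSpace (𝓡 3) x) :
    complexCombination σ r x v = ∑ i, (σ i x v : ℂ) * r i := by
  simp only [complexCombination]
  rw [sum_apply]
  simp

theorem chartPullback_complexCombination (σ : Fin 3 → OneForm M ℝ) (r : Fin 3 → ℂ) (x : M) :
    chartPullback (complexCombination σ r) x =
      fun y => ∑ i, ContinuousLinearMap.smulRightL ℝ E3 ℂ (chartPullback (σ i) x y) (r i) := by
  funext y
  ext V
  rw [sum_apply]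
  refine (complexCombination_apply σ r _ _).trans ?_
  simp [chartPullback]

theorem smoothFormOn_complexCombination {σ : Fin 3 → OneForm M ℝ} {U : Set M}
    (h : ∀ i, SmoothFormOn (σ i) U) (r : Fin 3 → ℂ) :
    SmoothFormOn (complexCombination σ r) U := by
  intro x hx
  rw [chartPullback_complexCombination]
  refine ContDiffAt.sum fun i _ => ?_
  exact (((ContinuousLinearMap.smulRightL ℝ E3 ℂ).flip (r i)).contDiff.contDiffAt).comp _ (h i x hx)

theorem dForm_complexCombination {σ : Fin 3 → OneForm M ℝ} {x : M}
    (h : ∀ i, SmoothFormOn (σ i) univ) (r : Fin 3 → ℂ) (v w : TangentSpace (𝓡 3) x) :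
    dForm (complexCombination σ r) x v w = ∑ i, ((dForm (σ i) x v w : ℝ) : ℂ) * r i := by
  have hd := fun i => (h i).differentiableAt (mem_univ x)
  have key : fderiv ℝ (chartPullback (complexCombination σ r) x) (chartAt E3 x x) =
      ∑ i, ((ContinuousLinearMap.smulRightL ℝ E3 ℂ).flip (r i)).comp
        (fderiv ℝ (chartPullback (σ i) x) (chartAt E3 x x)) := by
    rw [chartPullback_complexCombination]
    refine HasFDerivAt.fderiv (HasFDerivAt.fun_sum fun i _ => ?_)
    exact (((ContinuousLinearMap.smulRightL ℝ E3 ℂ).flip (r i)).hasFDerivAt).comp _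
      (hd i).hasFDerivAt
  rw [dForm_eq_fderiv ((smoothFormOn_complexCombination h r).differentiableAt (mem_univ x)), key]
  simp only [fun i => dForm_eq_fderiv (hd i) v w, Fin.sum_univ_three]
  simp
  ring

/-- The Leibniz rule for the product of a function and a `1`-form, near a point where the form does
not vanish. The function need not be assumed to be smooth. -/
theorem exists_dForm_eq_of_eventually_smul [IsManifold (𝓡 3) ∞ M] {U : Set M} (hU : IsOpen U)
    {x : M} (hx : x ∈ U) {ζ η : OneForm M ℂ} (hζ : SmoothFormOn ζ U) (hη : SmoothFormOn η U)
    (f : M → ℂ) (hf : ∀ y ∈ U, ∀ v, ζ y v = f y * η y v)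
    (v₀ : TangentSpace (𝓡 3) x) (hv₀ : η x v₀ ≠ 0) :
    ∃ df : TangentSpace (𝓡 3) x → ℂ, ∀ v w,
      dForm ζ x v w = df v * η x w - df w * η x v + f x * dForm η x v w := by
  set y₀ := chartAt E3 x x with hy₀
  set V₀ := chartD (chartAt E3 x) x v₀
  have hdζ := hζ.differentiableAt hx
  have hdη := hη.differentiableAt hx
  have hV₀ : chartPullback η x y₀ V₀ ≠ 0 := by
    rw [hy₀, chartPullback_chartD]; exact hv₀
  have hnear : ∀ᶠ y in 𝓝 y₀, (chartAt E3 x).symm y ∈ U := by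
    have hc : ContinuousAt (chartAt E3 x).symm y₀ :=
      (chartAt E3 x).continuousAt_symm (mem_chart_target E3 x)
    refine hc.eventually_mem ?_
    rw [hy₀, (chartAt E3 x).left_inv (mem_chart_source E3 x)]
    exact hU.mem_nhds hx
  have heq : ∀ᶠ y in 𝓝 y₀, ∀ V, chartPullback ζ x y V =
      f ((chartAt E3 x).symm y) * chartPullback η x y V := by
    filter_upwards [hnear] with y hy V using hf _ hy _
  have hdη₀ : DifferentiableAt ℝ (fun y => chartPullback η x y V₀) y₀ :=
    hdη.clm_apply (differentiableAt_const _)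
  -- On the fixed chart vector `V₀` the form η does not vanish near the point, so the factor is a
  -- quotient of two differentiable functions.
  have hg : DifferentiableAt ℝ (fun y => f ((chartAt E3 x).symm y)) y₀ := by
    have h1 : DifferentiableAt ℝ (fun y => chartPullback ζ x y V₀ * (chartPullback η x y V₀)⁻¹)
        y₀ :=
      (hdζ.clm_apply (differentiableAt_const _)).mul (hdη₀.inv hV₀)
    refine h1.congr_of_eventuallyEq ?_
    filter_upwards [heq, hdη₀.continuousAt.eventually_ne hV₀] with y hy hy'
    rw [hy V₀]
    field_simp
  have hder := (hg.hasFDerivAt.smul hdη.hasFDerivAt).congr_of_eventuallyEq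
    (f₁ := chartPullback ζ x) (by
      filter_upwards [heq] with y hy
      ext V
      simpa using hy V)
  refine ⟨fun v => fderiv ℝ (fun y => f ((chartAt E3 x).symm y)) y₀ (chartD (chartAt E3 x) x v),
    fun v w => ?_⟩
  rw [dForm_eq_fderiv hdζ, dForm_eq_fderiv hdη, hder.fderiv]
  have hs := fun v => chartPullback_chartD η x v
  have hfx : f ((chartAt E3 x).symm y₀) = f x := by
    rw [hy₀, (chartAt E3 x).left_inv (mem_chart_source E3 x)]
  simp only [← hs, ← hy₀, ← hfx]
  simp
  ring

end FormCalculus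

end TorsionFlow

namespace TorsionFlow

/-! ### The frame, and J_{a,1,c} as a pseudohermitian structure. -/

section Frame

theorem eq_sum_smul_of_dual {V : Type*} [AddCommGroup V] [Module ℝ V] [TopologicalSpace V]
    {n : ℕ} [NeZero n] {s : Fin n → V →L[ℝ] ℝ} {e : Fin n → V} (hn : Module.finrank ℝ V = n)
    (h : ∀ i j, s i (e j) = if i = j then 1 else 0) (v : V) : v = ∑ i, s i v • e i := by
  have hli : LinearIndependent ℝ e := by
    rw [Fintype.linearIndependent_iff]
    intro g hg i
    simpa [h] using congrArg (s i) hg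
  obtain ⟨r, rfl⟩ : ∃ r : Fin n → ℝ, v = ∑ i, r i • e i := by
    let b := basisOfLinearIndependentOfCardEqFinrank hli (by simp [hn])
    refine ⟨b.repr v, ?_⟩
    conv_lhs => rw [← b.sum_repr v]
    simp [b]
  simp [h]

variable {M : Type*} [TopologicalSpace M] [ChartedSpace E3 M]
variable {σ : Fin 3 → OneForm M ℝ} {X : Fin 3 → VField M}
  {C : Fin 3 → Fin 3 → Fin 3 → ℝ}

theorem eq_sum_frame (hdual : ∀ x i j, σ i x (X j x) = if i = j then 1 else 0) (x : M)
    (v : TangentSpace (𝓡 3) x) : v = ∑ i, σ i x v • X i x :=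
  eq_sum_smul_of_dual (V := E3) (s := fun i => σ i x) (e := fun i => X i x) finrank_euclideanSpace_fin
    (fun i j => hdual x i j) v

theorem ext_coframe (hdual : ∀ x i j, σ i x (X j x) = if i = j then 1 else 0) {x : M}
    {v w : TangentSpace (𝓡 3) x} (h : ∀ i, σ i x v = σ i x w) : v = w := by
  rw [eq_sum_frame hdual x v, eq_sum_frame hdual x w]
  simp only [h]

/-- The field of endomorphisms `α X₂ ⊗ σ² + γ X₃ ⊗ σ² - β X₂ ⊗ σ³ - α X₃ ⊗ σ³`. -/
noncomputable def tracelessEnd (σ : Fin 3 → OneForm M ℝ) (X : Fin 3 → VField M) (α β γ : ℝ) :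
    EndField M :=
  fun x => (σ 1 x).smulRight (α • X 1 x + γ • X 2 x) - (σ 2 x).smulRight (β • X 1 x + α • X 2 x)

theorem homJ_eq_tracelessEnd (a c : ℝ) : homJ σ X a c = tracelessEnd σ X a ((1 + a ^ 2) / c) c :=
  rfl

theorem tracelessEnd_apply (α β γ : ℝ) (x : M) (v : TangentSpace (𝓡 3) x) :
    tracelessEnd σ X α β γ x v = σ 1 x v • (α • X 1 x + γ • X 2 x) -
      σ 2 x v • (β • X 1 x + α • X 2 x) := rfl

section

variable (hdual : ∀ x i j, σ i x (X j x) = if i = j then 1 else 0)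
include hdual

theorem coframe_zero_tracelessEnd (α β γ : ℝ) (x : M) (v : TangentSpace (𝓡 3) x) :
    σ 0 x (tracelessEnd σ X α β γ x v) = 0 := by
  simp [tracelessEnd_apply, hdual]

theorem coframe_one_tracelessEnd (α β γ : ℝ) (x : M) (v : TangentSpace (𝓡 3) x) :
    σ 1 x (tracelessEnd σ X α β γ x v) = α * σ 1 x v - β * σ 2 x v := by
  simp [tracelessEnd_apply, hdual]
  ring

theorem coframe_two_tracelessEnd (α β γ : ℝ) (x : M) (v : TangentSpace (𝓡 3) x) :
    σ 2 x (tracelessEnd σ X α β γ x v) = γ * σ 1 x v - α * σ 2 x v := by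
  simp [tracelessEnd_apply, hdual]
  ring

end

variable (hM : IsHomogeneousContact σ X C (σ 0)) (hC : IsNormalizedBasis C)
include hM

theorem dForm_coframe (i : Fin 3) (x : M) (v w : TangentSpace (𝓡 3) x) :
    dForm (σ i) x v w =
      C i 0 1 * (σ 0 x v * σ 1 x w - σ 0 x w * σ 1 x v) +
      C i 0 2 * (σ 0 x v * σ 2 x w - σ 0 x w * σ 2 x v) +
      C i 1 2 * (σ 1 x v * σ 2 x w - σ 1 x w * σ 2 x v) := by
  rw [hM.structure_eq i x v w, Fin.sum_univ_three,
    show (Finset.Ioi 0 : Finset (Fin 3)) = {1, 2} from by decide,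
    show (Finset.Ioi 1 : Finset (Fin 3)) = {2} from by decide,
    show (Finset.Ioi 2 : Finset (Fin 3)) = ∅ from by decide]
  simp

include hC

theorem dForm_contact (x : M) (v w : TangentSpace (𝓡 3) x) :
    dForm (σ 0) x v w = σ 1 x v * σ 2 x w - σ 1 x w * σ 2 x v := by
  rw [dForm_coframe hM, hC.c123, hC.c112, hC.c113]
  ring

theorem coframe_eq_zero_of_reeb {x : M} {v : TangentSpace (𝓡 3) x}
    (h : ∀ w, dForm (σ 0) x v w = 0) : σ 1 x v = 0 ∧ σ 2 x v = 0 := by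
  constructor
  · simpa [dForm_contact hM hC, hM.dual] using h (X 2 x)
  · simpa [dForm_contact hM hC, hM.dual] using h (X 1 x)

theorem isPseudohermitian_homJ (a : ℝ) {c : ℝ} (hc : 0 < c) :
    IsPseudohermitian (σ 0) (homJ σ X a c) := by
  rw [homJ_eq_tracelessEnd]
  set b := (1 + a ^ 2) / c with hb
  have hbc : b * c = 1 + a ^ 2 := by rw [hb]; field_simp
  refine ⟨hM.contact, coframe_zero_tracelessEnd hM.dual _ _ _, ?_, ?_, ?_, ?_⟩
  · intro x v hv
    refine ext_coframe hM.dual fun i => ?_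
    fin_cases i
    · simp [coframe_zero_tracelessEnd hM.dual, hv]
    · simp only [Fin.mk_one, coframe_one_tracelessEnd hM.dual, coframe_two_tracelessEnd hM.dual,
        map_neg]
      linear_combination (-σ 1 x v) * hbc
    · simp only [Fin.reduceFinMk, coframe_one_tracelessEnd hM.dual,
        coframe_two_tracelessEnd hM.dual, map_neg]
      linear_combination (-σ 2 x v) * hbc
  · intro x v hv
    obtain ⟨h1, h2⟩ := coframe_eq_zero_of_reeb hM hC hv
    simp [tracelessEnd_apply, h1, h2]
  · intro x v w _ _
    simp only [dForm_contact hM hC, coframe_one_tracelessEnd hM.dual,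
      coframe_two_tracelessEnd hM.dual]
    ring
  · intro x v hv hv0
    simp only [dForm_contact hM hC, coframe_one_tracelessEnd hM.dual,
      coframe_two_tracelessEnd hM.dual]
    -- Since bc = 1 + a², the quadratic form dθ(v, Jv) becomes a sum of two squares after
    -- multiplication by c.
    have key : c * (σ 1 x v * (c * σ 1 x v - a * σ 2 x v) -
        (a * σ 1 x v - b * σ 2 x v) * σ 2 x v) =
        (c * σ 1 x v - a * σ 2 x v) ^ 2 + σ 2 x v ^ 2 := by
      linear_combination (σ 2 x v ^ 2) * hbc
    refine pos_of_mul_pos_right (a := c) ?_ hc.le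
    rw [key]
    by_contra hle
    have h2 : σ 2 x v = 0 := by nlinarith [sq_nonneg (c * σ 1 x v - a * σ 2 x v)]
    have h1 : c * σ 1 x v - a * σ 2 x v = 0 := by nlinarith [sq_nonneg (σ 2 x v)]
    have h1' : σ 1 x v = 0 := by
      simpa [h2, hc.ne'] using h1
    refine hv0 (ext_coframe hM.dual fun i => ?_)
    fin_cases i <;> simp [hv, h1', h2]

end Frame

/-! ### Admissible coframes of J_{a,1,c} and their torsion coefficient. -/

section TanakaWebster

variable {M : Type*} [TopologicalSpace M] [ChartedSpace E3 M]
variable {σ : Fin 3 → OneForm M ℝ} {X : Fin 3 → VField M}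
  {C : Fin 3 → Fin 3 → Fin 3 → ℝ}

/-- The coefficient `z` of the `(1,0)`-form `σ² + z σ³` of `J_{a,1,c}`. -/
noncomputable def typeCoeff (a c : ℝ) : ℂ := (Complex.I - a) / c

/-- The `(1,0)`-form `σ² + z σ³` of `J_{a,1,c}`. -/
noncomputable def typeForm (σ : Fin 3 → OneForm M ℝ) (a c : ℝ) : OneForm M ℂ :=
  complexCombination σ ![0, 1, typeCoeff a c]

theorem typeForm_apply (a c : ℝ) (x : M) (v : TangentSpace (𝓡 3) x) :
    typeForm σ a c x v = σ 1 x v + σ 2 x v * typeCoeff a c := by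
  simp [typeForm, Fin.sum_univ_three]

theorem dForm_typeForm (hsmooth : ∀ i, SmoothFormOn (σ i) univ) (a c : ℝ) (x : M)
    (v w : TangentSpace (𝓡 3) x) : dForm (typeForm σ a c) x v w =
      (dForm (σ 1) x v w : ℝ) + (dForm (σ 2) x v w : ℝ) * typeCoeff a c := by
  simp [typeForm, dForm_complexCombination hsmooth, Fin.sum_univ_three]

theorem star_typeCoeff (a c : ℝ) : star (typeCoeff a c) = (-Complex.I - a) / c := by
  simp [typeCoeff]

theorem typeCoeff_sub_star (a c : ℝ) :
    typeCoeff a c - star (typeCoeff a c) = 2 * Complex.I / c := by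
  rw [star_typeCoeff, typeCoeff]
  ring

variable (hM : IsHomogeneousContact σ X C (σ 0)) (hC : IsNormalizedBasis C)
include hM hC

/-- `X 0` is the Reeb field, so the form vanishes on it, and type (1,0) applied to J X₂ = aX₂ + cX₃
fixes the value on X₃ in terms of that on X₂. -/
theorem IsTanakaWebster.eq_mul_typeForm {a c : ℝ} (hc : 0 < c) {U : Set M} {θ1 conn : OneForm M ℂ}
    {A : M → ℂ} (h : IsTanakaWebster (σ 0) (homJ σ X a c) U θ1 conn A) {x : M} (hx : x ∈ U)
    (v : TangentSpace (𝓡 3) x) : θ1 x v = θ1 x (X 1 x) * typeForm σ a c x v := by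
  have h0 : θ1 x (X 0 x) = 0 := h.reeb x hx _ fun w => by
    simp [dForm_contact hM hC, hM.dual]
  have h1 := h.type10 x hx (X 1 x)
  have hJ : homJ σ X a c x (X 1 x) = a • X 1 x + c • X 2 x := by
    simp [homJ_eq_tracelessEnd, tracelessEnd_apply, hM.dual]
  rw [hJ, map_add, map_smul, map_smul, Complex.real_smul, Complex.real_smul] at h1
  have hc' : (c : ℂ) ≠ 0 := by exact_mod_cast hc.ne'
  have h2 : θ1 x (X 2 x) = typeCoeff a c * θ1 x (X 1 x) := by
    rw [typeCoeff]
    field_simp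
    linear_combination h1
  conv_lhs => rw [eq_sum_frame hM.dual x v]
  rw [map_sum, Fin.sum_univ_three, typeForm_apply]
  simp only [map_smul, Complex.real_smul, h0, h2]
  ring

theorem IsTanakaWebster.frame_ne_zero {a c : ℝ} {U : Set M} {θ1 conn : OneForm M ℂ}
    {A : M → ℂ} (h : IsTanakaWebster (σ 0) (homJ σ X a c) U θ1 conn A) {x : M} (hx : x ∈ U) :
    θ1 x (X 1 x) ≠ 0 := by
  intro h0
  have h1 := h.normalized x hx (X 1 x) (X 2 x)
  rw [h0] at h1
  simp [dForm_contact hM hC, hM.dual] at h1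

/-- The torsion coefficient with respect to the coframe `σ² + z σ³`, as determined by the first
structure equation. -/
theorem IsTanakaWebster.torsion_eq [IsManifold (𝓡 3) ∞ M] {a c : ℝ} (hc : 0 < c) {U : Set M}
    (hU : IsOpen U) {θ1 conn : OneForm M ℂ}
    {A : M → ℂ} (h : IsTanakaWebster (σ 0) (homJ σ X a c) U θ1 conn A) {x : M} (hx : x ∈ U) :
    A x * star (θ1 x (X 1 x)) * (2 * Complex.I / c) =
      θ1 x (X 1 x) * (C 2 0 1 * typeCoeff a c ^ 2 - C 1 0 2) := by
  have hη : SmoothFormOn (typeForm σ a c) U := fun y _ =>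
    smoothFormOn_complexCombination hM.smooth _ y (mem_univ y)
  obtain ⟨df, hdf⟩ := exists_dForm_eq_of_eventually_smul hU hx h.smooth_coframe hη
    (fun y => θ1 y (X 1 y)) (fun y hy v => h.eq_mul_typeForm hM hC hc hy v) (X 1 x)
    (by simp [typeForm_apply, hM.dual])
  have h0 : θ1 x (X 0 x) = 0 := by
    rw [h.eq_mul_typeForm hM hC hc hx]; simp [typeForm_apply, hM.dual]
  have h2 : θ1 x (X 2 x) = θ1 x (X 1 x) * typeCoeff a c := by
    rw [h.eq_mul_typeForm hM hC hc hx]; simp [typeForm_apply, hM.dual]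
  -- The unknowns are the differential of the factor and the connection form, both on the Reeb
  -- field. They enter the two equations in the ratio 1 : z, and cancel in `e2 - z * e1`.
  have e1 := (hdf (X 0 x) (X 1 x)).symm.trans (h.structure_eq x hx (X 0 x) (X 1 x))
  have e2 := (hdf (X 0 x) (X 2 x)).symm.trans (h.structure_eq x hx (X 0 x) (X 2 x))
  simp only [dForm_typeForm hM.smooth, typeForm_apply, dForm_coframe hM, hM.dual, h0, h2, hC.c212,
    hC.c313, star_mul'] at e1 e2
  rw [← typeCoeff_sub_star]
  simp at e1 e2 ⊢
  linear_combination e2 - typeCoeff a c * e1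

end TanakaWebster

end TorsionFlow

namespace TorsionFlow

/-! ### Torsion tensor and Webster curvature of J_{a,1,c}. -/

section Flow

/-- Twice the torsion of `J_{a,1,c}` is `u • J` up to a constant endomorphism, where
`u = c²₁₃ c - c³₁₂ (1 + a²) / c`. -/
noncomputable def growthRate (p q a c : ℝ) : ℝ := p * c - q * ((1 + a ^ 2) / c)

theorem re_typeCoeff (a c : ℝ) : (typeCoeff a c).re = -a / c := by
  simp [typeCoeff, Complex.div_ofReal_re]

theorem im_typeCoeff (a c : ℝ) : (typeCoeff a c).im = 1 / c := by
  simp [typeCoeff, Complex.div_ofReal_im]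

theorem torsion_coefficient_iff (p q a : ℝ) {c : ℝ} (hc : 0 < c) (α γ : ℝ) :
    (α + γ * typeCoeff a c) * (2 * Complex.I / c) = q * typeCoeff a c ^ 2 - p ↔
      2 * α = a * growthRate p q a c ∧ 2 * γ = c * growthRate p q a c + 2 * q := by
  have hc' : (c : ℂ) ≠ 0 := by exact_mod_cast hc.ne'
  have h1 : (α + γ * typeCoeff a c) * (2 * Complex.I / c) = q * typeCoeff a c ^ 2 - p ↔
      (α * c + γ * (Complex.I - a)) * (2 * Complex.I) = q * (Complex.I - a) ^ 2 - p * c ^ 2 := by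
    rw [typeCoeff]
    field_simp
  rw [h1, Complex.ext_iff]
  simp only [growthRate, pow_two, Complex.add_re, Complex.add_im, Complex.mul_re, Complex.mul_im,
    Complex.sub_re, Complex.sub_im, Complex.ofReal_re, Complex.ofReal_im, Complex.I_re,
    Complex.I_im, Complex.re_ofNat, Complex.im_ofNat]
  have e1 : 2 * α = a * (p * c - q * ((1 + a * a) / c)) ↔
      2 * α * c = a * (p * c * c - q * (1 + a * a)) := by
    field_simp
  have e2 : c * (p * c - q * ((1 + a * a) / c)) + 2 * q = p * c * c - q * (1 + a * a) + 2 * q := by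
    field_simp
  rw [e1, e2]
  constructor
  · rintro ⟨hr, hi⟩
    exact ⟨by linear_combination hi - a * hr, by linear_combination -hr⟩
  · rintro ⟨hα, hγ⟩
    exact ⟨by linear_combination -hγ, by linear_combination hα - a * hγ⟩

variable {M : Type*} [TopologicalSpace M] [ChartedSpace E3 M]
variable {σ : Fin 3 → OneForm M ℝ} {X : Fin 3 → VField M}
  {C : Fin 3 → Fin 3 → Fin 3 → ℝ}
variable (hM : IsHomogeneousContact σ X C (σ 0)) (hC : IsNormalizedBasis C)
include hM hC

/-- The factor relating the coframe to σ² + zσ³ cancels, so the values do not depend on the local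
coframe. The image of `X 1` suffices, since it carries the derivatives of a and c under the flow. -/
theorem IsTorsionTensor.coframe_eq [IsManifold (𝓡 3) ∞ M] {a c : ℝ} (hc : 0 < c) {S : EndField M}
    (hS : IsTorsionTensor (σ 0) (homJ σ X a c) S) (x : M) :
    2 * σ 1 x (S x (X 1 x)) = a * growthRate (C 1 0 2) (C 2 0 1) a c ∧
    2 * σ 2 x (S x (X 1 x)) = c * growthRate (C 1 0 2) (C 2 0 1) a c + 2 * C 2 0 1 := by
  obtain ⟨U, hU, hx, θ1, conn, A, h, hv⟩ := hS x
  rw [← torsion_coefficient_iff (C 1 0 2) (C 2 0 1) a hc]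
  have hne := h.frame_ne_zero hM hC hx
  refine mul_left_cancel₀ hne ?_
  rw [← h.torsion_eq hM hC hc hU hx, ← (hv (X 1 x)).2, h.eq_mul_typeForm hM hC hc hx (S x (X 1 x)),
    typeForm_apply]
  ring

/-- The coframe is f(σ² + zσ³), where the normalization of dθ forces f² = c/2. A connection form
with constant imaginary coefficients leaves one complex equation for each of the three basic
2-forms. -/
theorem exists_isTanakaWebster (a : ℝ) {c α γ : ℝ} (hc : 0 < c)
    (hα : 2 * α = a * growthRate (C 1 0 2) (C 2 0 1) a c)
    (hγ : 2 * γ = c * growthRate (C 1 0 2) (C 2 0 1) a c + 2 * C 2 0 1) :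
    ∃ (μ : Fin 3 → ℝ) (f : ℝ), 2 * f ^ 2 = c ∧
      IsTanakaWebster (σ 0) (homJ σ X a c) univ (complexCombination σ ![0, f, f * typeCoeff a c])
        (complexCombination σ fun i => μ i * Complex.I) fun _ => α + γ * typeCoeff a c := by
  set p := C 1 0 2
  set q := C 2 0 1
  have hf : 2 * √(c / 2) ^ 2 = c := by rw [Real.sq_sqrt (by positivity)]; ring
  set f := √(c / 2)
  have hc' : (c : ℂ) ≠ 0 := by exact_mod_cast hc.ne'
  have hbc : (1 + a ^ 2) / c * c = 1 + a ^ 2 := by field_simp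
  set u := growthRate p q a c with hu
  have huc : u * c = p * c ^ 2 - q * (1 + a ^ 2) := by
    rw [hu, growthRate]; field_simp
  -- `μ₁` and `μ₂` come from the real and imaginary parts of `e12` multiplied by c.
  set μ₁ := c * C 1 1 2 - a * C 2 1 2 with hμ₁
  set μ₂ := (C 2 1 2 - a * μ₁) / c with hμ₂
  have hμ₂' : μ₂ * c = C 2 1 2 - a * μ₁ := by rw [hμ₂]; field_simp
  set z := typeCoeff a c with hz
  have hzc : z * c = Complex.I - a := by rw [hz, typeCoeff]; field_simp
  have hzs : star z * c = -Complex.I - a := by rw [hz, star_typeCoeff]; field_simp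
  have hI : Complex.I ^ 2 = -1 := Complex.I_sq
  -- the coefficients of `σ¹ ∧ σ²`, `σ¹ ∧ σ³` and `σ² ∧ σ³` in the structure equation
  have hα' : 2 * (α : ℂ) = a * u := by exact_mod_cast hα
  have hγ' : 2 * (γ : ℂ) = c * u + 2 * q := by exact_mod_cast hγ
  have huc' : (u : ℂ) * c = p * c ^ 2 - q * (1 + a ^ 2) := by exact_mod_cast huc
  have e01 : z * q = -((u / 2 : ℝ) * Complex.I) + (α + γ * z) := by
    push_cast
    linear_combination -hα' / 2 - z * hγ' / 2 - u / 2 * hzc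
  have e02 : (p : ℂ) = -(z * ((u / 2 : ℝ) * Complex.I)) + (α + γ * z) * star z := by
    refine mul_right_cancel₀ (pow_ne_zero 2 hc') ?_
    push_cast
    have hzz : z * star z * c ^ 2 = 1 + a ^ 2 := by
      linear_combination star z * c * hzc + (Complex.I - a) * hzs - hI
    linear_combination (-(1 / 2) * star z * c ^ 2) * hα' - (1 / 2) * z * star z * c ^ 2 * hγ' +
      (1 / 2 * u * c * Complex.I) * hzc - (1 / 2 * a * u * c) * hzs - (1 / 2 * c * u + q) * hzz +
      (1 / 2) * u * c * hI - huc'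
  have e12 : (C 1 1 2 : ℂ) + C 2 1 2 * z = (μ₂ : ℝ) * Complex.I - z * ((μ₁ : ℝ) * Complex.I) := by
    refine mul_right_cancel₀ hc' ?_
    have h1 : (μ₂ : ℂ) * c = C 2 1 2 - a * μ₁ := by exact_mod_cast hμ₂'
    have h2 : (μ₁ : ℂ) = c * C 1 1 2 - a * C 2 1 2 := by exact_mod_cast hμ₁
    linear_combination (C 2 1 2 + μ₁ * Complex.I) * hzc - Complex.I * h1 - h2 + μ₁ * hI
  have hcoframe : ∀ x v, complexCombination σ ![0, (f : ℂ), f * z] x v =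
      f * (σ 1 x v + σ 2 x v * z) := fun x v => by
    simp [Fin.sum_univ_three]; ring
  refine ⟨![u / 2, μ₁, μ₂], f, hf, fun x _ => smoothFormOn_complexCombination hM.smooth _ x
    (mem_univ x), fun x _ => smoothFormOn_complexCombination hM.smooth _ x (mem_univ x),
    ?_, ?_, ?_, ?_, ?_⟩
  · intro x _ v
    rw [hcoframe, hcoframe, homJ_eq_tracelessEnd, coframe_one_tracelessEnd hM.dual,
      coframe_two_tracelessEnd hM.dual]
    refine mul_right_cancel₀ hc' ?_
    have hbc' : (((1 + a ^ 2) / c : ℝ) : ℂ) * c = 1 + a ^ 2 := by exact_mod_cast hbc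
    push_cast at hbc' ⊢
    linear_combination (f * (c * σ 1 x v - a * σ 2 x v - Complex.I * σ 2 x v)) * hzc -
      (f * σ 2 x v) * hbc' - f * σ 2 x v * hI
  · intro x _ v hv
    obtain ⟨h1, h2⟩ := coframe_eq_zero_of_reeb hM hC hv
    rw [hcoframe, h1, h2]; simp
  · intro x _ v w
    rw [dForm_contact hM hC, hcoframe, hcoframe]
    have hf' : 2 * (f : ℂ) ^ 2 = c := by exact_mod_cast hf
    have hs : star z = z - 2 * Complex.I / c := by
      rw [← typeCoeff_sub_star a c]; ring
    simp only [star_mul', star_add, Complex.star_def, Complex.conj_ofReal]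
    simp only [← Complex.star_def, hs]
    push_cast
    have : Complex.I * (2 * Complex.I / c) * f ^ 2 = -1 := by
      field_simp
      linear_combination Complex.I ^ 2 * hf' + c * hI
    linear_combination ((σ 1 x v * σ 2 x w - σ 1 x w * σ 2 x v) : ℂ) * this
  · intro x _ v w
    rw [dForm_complexCombination hM.smooth, hcoframe, hcoframe]
    simp only [complexCombination_apply, dForm_coframe hM, Fin.sum_univ_three, star_mul', star_add,
      Complex.star_def, Complex.conj_ofReal, hC.c212, hC.c313]
    simp only [← Complex.star_def]
    simp
    simp only [← Complex.star_def]
    push_cast at e01 e02 e12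
    linear_combination
      f * (σ 0 x v * σ 1 x w - σ 0 x w * σ 1 x v) * e01 +
      f * (σ 0 x v * σ 2 x w - σ 0 x w * σ 2 x v) * e02 +
      f * (σ 1 x v * σ 2 x w - σ 1 x w * σ 2 x v) * e12
  · intro x _ v
    simp only [complexCombination_apply, Fin.sum_univ_three]
    simp
    ring

/-- The torsion tensor of `J_{a,1,c}`. -/
theorem isTorsionTensor_tracelessEnd (a : ℝ) {c α β γ : ℝ} (hc : 0 < c)
    (hα : 2 * α = a * growthRate (C 1 0 2) (C 2 0 1) a c)
    (hβ : 2 * β = (1 + a ^ 2) / c * growthRate (C 1 0 2) (C 2 0 1) a c - 2 * C 1 0 2)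
    (hγ : 2 * γ = c * growthRate (C 1 0 2) (C 2 0 1) a c + 2 * C 2 0 1) :
    IsTorsionTensor (σ 0) (homJ σ X a c) (tracelessEnd σ X α β γ) := by
  obtain ⟨μ, f, -, h⟩ := exists_isTanakaWebster hM hC a hc hα hγ
  refine fun x => ⟨univ, isOpen_univ, mem_univ x, _, _, _, h, fun v =>
    ⟨coframe_zero_tracelessEnd hM.dual _ _ _ x v, ?_⟩⟩
  simp only [complexCombination_apply, Fin.sum_univ_three, coframe_one_tracelessEnd hM.dual,
    coframe_two_tracelessEnd hM.dual, growthRate] at hα hβ hγ ⊢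
  have hc' := hc.ne'
  have hα' : α = a * (C 1 0 2 * c - C 2 0 1 * ((1 + a ^ 2) / c)) / 2 := by linarith
  have hγ' : γ = (c * (C 1 0 2 * c - C 2 0 1 * ((1 + a ^ 2) / c)) + 2 * C 2 0 1) / 2 := by linarith
  have hβ' : β = ((1 + a ^ 2) / c * (C 1 0 2 * c - C 2 0 1 * ((1 + a ^ 2) / c)) -
      2 * C 1 0 2) / 2 := by linarith
  apply Complex.ext
  · simp [re_typeCoeff, im_typeCoeff]
    rw [hα', hβ', hγ']
    field_simp
    ring
  · simp [re_typeCoeff, im_typeCoeff]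
    rw [hα', hγ']
    field_simp
    ring

/-- Only constancy is needed: it makes W equal to its mean, so that θ is stationary. -/
theorem exists_isWebsterCurvature_const (a : ℝ) {c : ℝ} (hc : 0 < c) :
    ∃ W : ℝ, IsWebsterCurvature (σ 0) (homJ σ X a c) fun _ => W := by
  obtain ⟨μ, f, hf, h⟩ := exists_isTanakaWebster hM hC a hc
    (α := a * growthRate (C 1 0 2) (C 2 0 1) a c / 2)
    (γ := (c * growthRate (C 1 0 2) (C 2 0 1) a c + 2 * C 2 0 1) / 2) (by ring) (by ring)
  refine ⟨-(μ 0 + μ 1 * C 1 1 2 + μ 2 * C 2 1 2), fun x => ⟨univ, isOpen_univ, mem_univ x, _, _, _,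
    h, fun v w hv hw => ?_⟩⟩
  have hc' : (c : ℂ) ≠ 0 := by exact_mod_cast hc.ne'
  have hf' : 2 * (f : ℂ) ^ 2 = c := by exact_mod_cast hf
  have hs : star (typeCoeff a c) = typeCoeff a c - 2 * Complex.I / c := by
    rw [← typeCoeff_sub_star a c]; ring
  rw [dForm_complexCombination hM.smooth]
  simp only [complexCombination_apply, dForm_coframe hM, Fin.sum_univ_three, hC.c123, hv, hw,
    star_add, star_mul', Complex.star_def, Complex.conj_ofReal]
  simp
  simp only [← Complex.star_def, hs]
  have : (2 * Complex.I / c) * f ^ 2 = Complex.I := by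
    field_simp
    linear_combination hf'
  linear_combination (-(μ 0 + μ 1 * C 1 1 2 + μ 2 * C 2 1 2) *
    (σ 1 x v * σ 2 x w - σ 1 x w * σ 2 x v) : ℂ) * this

theorem isTorsionFree_iff [IsManifold (𝓡 3) ∞ M] [Nonempty M] (a : ℝ) {c : ℝ} (hc : 0 < c) :
    IsTorsionFree σ X a c ↔ a * growthRate (C 1 0 2) (C 2 0 1) a c = 0 ∧
      c * growthRate (C 1 0 2) (C 2 0 1) a c + 2 * C 2 0 1 = 0 := by
  constructor
  · intro h
    obtain ⟨x⟩ := ‹Nonempty M›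
    obtain ⟨h1, h2⟩ := IsTorsionTensor.coframe_eq hM hC hc h x
    have h0 : ∀ i, σ i x ((0 : TangentSpace (𝓡 3) x →L[ℝ] TangentSpace (𝓡 3) x) (X 1 x)) = 0 :=
      fun i => by simp
    exact ⟨by rw [← h1, h0, mul_zero], by rw [← h2, h0, mul_zero]⟩
  · rintro ⟨h1, h2⟩
    have h3 : (1 + a ^ 2) / c * growthRate (C 1 0 2) (C 2 0 1) a c - 2 * C 1 0 2 = 0 := by
      have h4 : growthRate (C 1 0 2) (C 2 0 1) a c * c =
          C 1 0 2 * c ^ 2 - C 2 0 1 * (1 + a ^ 2) := by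
        rw [growthRate]; field_simp
      have : (1 + a ^ 2) * growthRate (C 1 0 2) (C 2 0 1) a c - 2 * C 1 0 2 * c = 0 := by
        refine mul_left_cancel₀ hc.ne' ?_
        linear_combination (2 * a * c) * h1 - (1 + a ^ 2) * h2 + 2 * h4
      field_simp
      linear_combination this
    have h := isTorsionTensor_tracelessEnd hM hC a (α := 0) (β := 0) (γ := 0) hc
      (by rw [h1]; simp) (by rw [h3]; simp) (by rw [h2]; simp)
    have h0 : tracelessEnd σ X 0 0 0 = fun _ => 0 := by
      funext x
      ext v
      simp [tracelessEnd_apply]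
    rwa [h0] at h

end Flow

end TorsionFlow

namespace TorsionFlow

/-! ### Equivalence of the homogeneous flow with an ordinary differential equation. -/

section Coefficients

/-- The functions `a` and `c > 0` solve the ordinary differential equations of the coefficients of
`J_{a,1,c}` under the torsion flow, with `p = c²₁₃` and `q = c³₁₂`. -/
def IsCoefficientSolution (p q : ℝ) (a c : ℝ → ℝ) (I : Set ℝ) : Prop :=
  ∀ t ∈ I, 0 < c t ∧ HasDerivWithinAt a (a t * growthRate p q (a t) (c t)) I t ∧
    HasDerivWithinAt c (c t * growthRate p q (a t) (c t) + 2 * q) I t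

/-- The entry b obeys an equation of the same shape as c. This lets u = pc - qb satisfy an
autonomous Riccati equation. -/
theorem IsCoefficientSolution.hasDerivWithinAt_div {p q : ℝ} {a c : ℝ → ℝ} {I : Set ℝ}
    (h : IsCoefficientSolution p q a c I) {t : ℝ} (ht : t ∈ I) :
    HasDerivWithinAt (fun s => (1 + a s ^ 2) / c s)
      ((1 + a t ^ 2) / c t * growthRate p q (a t) (c t) - 2 * p) I t := by
  obtain ⟨hc, ha', hc'⟩ := h t ht
  refine (((ha'.pow 2).const_add 1).div hc' hc.ne').congr_deriv ?_
  simp only [growthRate, Pi.pow_apply]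
  field_simp
  ring

theorem IsCoefficientSolution.hasDerivWithinAt_growthRate {p q : ℝ} {a c : ℝ → ℝ} {I : Set ℝ}
    (h : IsCoefficientSolution p q a c I) {t : ℝ} (ht : t ∈ I) :
    HasDerivWithinAt (fun s => growthRate p q (a s) (c s))
      (growthRate p q (a t) (c t) ^ 2 + 4 * p * q) I t := by
  refine (((h t ht).2.2.const_mul p).sub ((h.hasDerivWithinAt_div ht).const_mul q)).congr_deriv ?_
  simp only [growthRate]
  ring

variable {M : Type*} [TopologicalSpace M] [ChartedSpace E3 M]
variable {σ : Fin 3 → OneForm M ℝ} {X : Fin 3 → VField M}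
  {C : Fin 3 → Fin 3 → Fin 3 → ℝ}
theorem coframe_homJ_frame_one (hM : IsHomogeneousContact σ X C (σ 0)) (a c : ℝ) (x : M) :
    σ 1 x (homJ σ X a c x (X 1 x)) = a ∧ σ 2 x (homJ σ X a c x (X 1 x)) = c ∧
      σ 1 x (homJ σ X a c x (X 2 x)) = -((1 + a ^ 2) / c) := by
  simp [homJ_eq_tracelessEnd, coframe_one_tracelessEnd hM.dual, coframe_two_tracelessEnd hM.dual,
    hM.dual]

variable [MeasurableSpace M] (hM : IsHomogeneousContact σ X C (σ 0)) (hC : IsNormalizedBasis C)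
include hM hC

theorem IsHomogeneousFlow.isCoefficientSolution [IsManifold (𝓡 3) ∞ M] [Nonempty M] {a₀ c₀ : ℝ}
    {a c : ℝ → ℝ} {I : Set ℝ} (h : IsHomogeneousFlow σ X a₀ c₀ a c I) :
    IsCoefficientSolution (C 1 0 2) (C 2 0 1) a c I := by
  intro t ht
  obtain ⟨x⟩ := ‹Nonempty M›
  obtain ⟨-, S, W, m, hS, -, -, hJ, -⟩ := h.flow t ht
  obtain ⟨h1, h2⟩ := hS.coframe_eq hM hC (h.pos t ht) x
  have hd : ∀ i, HasDerivWithinAt (fun s => σ i x (homJ σ X (a s) (c s) x (X 1 x)))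
      (2 * σ i x (S x (X 1 x))) I t := fun i => by
    have := HasFDerivAt.comp_hasDerivWithinAt (F := E3) (l := fun v => σ i x v) t
      (ContinuousLinearMap.hasFDerivAt (E := E3) (σ i x)) (hJ x (X 1 x))
    refine this.congr_deriv ?_
    exact ((σ i x).map_smul 2 _)
  refine ⟨h.pos t ht, ?_, ?_⟩
  · have := hd 1
    rw [h1] at this
    exact this.congr_of_mem (fun s _ => (coframe_homJ_frame_one hM _ _ x).1.symm) ht
  · have := hd 2
    rw [h2] at this
    exact this.congr_of_mem (fun s _ => (coframe_homJ_frame_one hM _ _ x).2.1.symm) ht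

theorem IsCoefficientSolution.isHomogeneousFlow {a₀ c₀ : ℝ} {a c : ℝ → ℝ} {I : Set ℝ}
    (h : IsCoefficientSolution (C 1 0 2) (C 2 0 1) a c I) (ha : a 0 = a₀) (hc : c 0 = c₀) :
    IsHomogeneousFlow σ X a₀ c₀ a c I := by
  refine ⟨fun t ht => (h t ht).1, ⟨ha, hc⟩, fun t ht => ?_⟩
  obtain ⟨hc, ha', hc'⟩ := h t ht
  have hb' := h.hasDerivWithinAt_div ht
  obtain ⟨W, hW⟩ := exists_isWebsterCurvature_const hM hC (a t) hc
  refine ⟨isPseudohermitian_homJ hM hC (a t) hc, _, _, W,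
    isTorsionTensor_tracelessEnd hM hC (a t) hc (mul_div_cancel₀ _ two_ne_zero)
      (mul_div_cancel₀ _ two_ne_zero) (mul_div_cancel₀ _ two_ne_zero), hW, ?_, fun x v => ?_,
    fun x v => ?_⟩
  -- W - W̄ is identically zero, so the total volume need not be finite.
  · simp [IsMeanValue]
  · have key : ∀ e₁ e₂ : E3, ∀ s₁ s₂ : ℝ, HasDerivWithinAt
        (fun s => s₁ • (a s • e₁ + c s • e₂) - s₂ • (((1 + a s ^ 2) / c s) • e₁ + a s • e₂))
        ((2 : ℝ) • (s₁ • ((a t * growthRate (C 1 0 2) (C 2 0 1) (a t) (c t) / 2) • e₁ +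
          ((c t * growthRate (C 1 0 2) (C 2 0 1) (a t) (c t) + 2 * C 2 0 1) / 2) • e₂) -
          s₂ • ((((1 + a t ^ 2) / c t * growthRate (C 1 0 2) (C 2 0 1) (a t) (c t) -
            2 * C 1 0 2) / 2) • e₁ +
            (a t * growthRate (C 1 0 2) (C 2 0 1) (a t) (c t) / 2) • e₂))) I t := by
      intro e₁ e₂ s₁ s₂
      refine ((((ha'.smul_const e₁).add (hc'.smul_const e₂)).const_smul s₁).sub
        (((hb'.smul_const e₁).add (ha'.smul_const e₂)).const_smul s₂)).congr_deriv ?_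
      module
    exact key (X 1 x) (X 2 x) (σ 1 x v) (σ 2 x v)
  · simpa using hasDerivWithinAt_const t I (σ 0 x v)

end Coefficients

/-! ### Explicit integration through the linear equation φ'' = k²φ. -/

section Riccati

/-- The solution of `φ'' = k² φ` with `φ 0 = 1` and `φ' 0 = -u₀`. -/
noncomputable def riccatiDenom (k u₀ t : ℝ) : ℝ := Real.cosh (k * t) - u₀ / k * Real.sinh (k * t)

/-- The integral of `riccatiDenom k u₀` from `0`. -/
noncomputable def riccatiInt (k u₀ t : ℝ) : ℝ :=
  Real.sinh (k * t) / k - u₀ / k ^ 2 * (Real.cosh (k * t) - 1)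

variable {k u₀ : ℝ}

@[simp]
theorem riccatiDenom_zero : riccatiDenom k u₀ 0 = 1 := by simp [riccatiDenom]

@[simp]
theorem riccatiInt_zero : riccatiInt k u₀ 0 = 0 := by simp [riccatiInt]

/-- This is the first integral φ'² - k²φ² = u₀² - k², with φ' = k²Φ - u₀. -/
theorem riccatiDenom_sq (hk : k ≠ 0) (t : ℝ) : riccatiDenom k u₀ t ^ 2 =
    1 - 2 * u₀ * riccatiInt k u₀ t + k ^ 2 * riccatiInt k u₀ t ^ 2 := by
  have h := Real.cosh_sq (k * t)
  simp only [riccatiDenom, riccatiInt]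
  field_simp
  linear_combination (k ^ 2 - u₀ ^ 2) * h

theorem hasDerivAt_riccatiDenom (hk : k ≠ 0) (t : ℝ) :
    HasDerivAt (riccatiDenom k u₀) (k ^ 2 * riccatiInt k u₀ t - u₀) t := by
  have h1 : HasDerivAt (fun s => k * s) k t := by simpa using (hasDerivAt_id t).const_mul k
  refine (h1.cosh.sub (h1.sinh.const_mul (u₀ / k))).congr_deriv ?_
  simp only [riccatiInt]
  field_simp
  ring

theorem hasDerivAt_riccatiInt (hk : k ≠ 0) (t : ℝ) :
    HasDerivAt (riccatiInt k u₀) (riccatiDenom k u₀ t) t := by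
  have h1 : HasDerivAt (fun s => k * s) k t := by simpa using (hasDerivAt_id t).const_mul k
  refine ((h1.sinh.div_const k).sub ((h1.cosh.sub_const 1).const_mul (u₀ / k ^ 2))).congr_deriv ?_
  simp only [riccatiDenom]
  field_simp

/-- Grönwall on each [0, t], where u is bounded; u may be unbounded near T. -/
theorem eqOn_zero_of_linear_ode {w u : ℝ → ℝ} {T : ℝ} (hu : ContinuousOn u (Ico 0 T))
    (hw : ∀ t ∈ Ico 0 T, HasDerivWithinAt w (u t * w t) (Ico 0 T) t) (h0 : w 0 = 0) :
    ∀ t ∈ Ico 0 T, w t = 0 := by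
  intro t ht
  have hsub : Icc 0 t ⊆ Ico 0 T := fun s hs => ⟨hs.1, hs.2.trans_lt ht.2⟩
  obtain ⟨K, hK⟩ := isCompact_Icc.exists_bound_of_continuousOn (hu.mono hsub)
  refine eq_zero_of_abs_deriv_le_mul_abs_self_of_eq_zero_right (f' := fun s => u s * w s) (K := K)
    (a := 0) (b := t) (fun s hs => (hw s (hsub hs)).continuousWithinAt.mono hsub) (fun s hs => ?_)
    h0 (fun s hs => ?_) t ⟨ht.1, le_rfl⟩
  · refine (hw s (hsub (Ico_subset_Icc_self hs))).mono_of_mem_nhdsWithin ?_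
    have h1 : Ico s T ∈ 𝓝[Ici s] s := Ico_mem_nhdsGE (hs.2.trans ht.2)
    exact mem_of_superset h1 fun r hr => ⟨hs.1.trans hr.1, hr.2⟩
  · rw [norm_mul]
    exact mul_le_mul_of_nonneg_right (hK s (Ico_subset_Icc_self hs)) (norm_nonneg _)

/-- The coefficients, multiplied by the solution of the linear equation that belongs to the Riccati
equation of their growth rate. -/
theorem IsCoefficientSolution.mul_riccatiDenom {p q a₀ c₀ : ℝ} {a c : ℝ → ℝ} {T : ℝ}
    (h : IsCoefficientSolution p q a c (Ico 0 T)) (ha : a 0 = a₀) (hc : c 0 = c₀)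
    (hk : k ≠ 0) (hkpq : k ^ 2 = -4 * p * q) (hu₀ : u₀ = growthRate p q a₀ c₀) :
    ∀ t ∈ Ico 0 T, a t * riccatiDenom k u₀ t = a₀ ∧
      c t * riccatiDenom k u₀ t = c₀ + 2 * q * riccatiInt k u₀ t ∧
      growthRate p q (a t) (c t) * riccatiDenom k u₀ t = u₀ - k ^ 2 * riccatiInt k u₀ t := by
  subst ha hc
  have hu := fun t ht => h.hasDerivWithinAt_growthRate (t := t) ht
  have hφ := fun t => (hasDerivAt_riccatiDenom (u₀ := u₀) hk t).hasDerivWithinAt (s := Ico 0 T)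
  have hΦ := fun t => (hasDerivAt_riccatiInt (u₀ := u₀) hk t).hasDerivWithinAt (s := Ico 0 T)
  -- The quantity w = φ' + uφ satisfies w' = uw and w(0) = 0. Nothing is divided by φ, so the
  -- identity also holds at zeros of φ.
  have hw : ∀ t ∈ Ico 0 T, k ^ 2 * riccatiInt k u₀ t - u₀ +
      growthRate p q (a t) (c t) * riccatiDenom k u₀ t = 0 := by
    refine eqOn_zero_of_linear_ode (fun t ht => (hu t ht).continuousWithinAt) (fun t ht => ?_)
      (by simp [hu₀])
    refine ((((hΦ t).const_mul (k ^ 2)).sub_const u₀).add ((hu t ht).mul (hφ t))).congr_deriv ?_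
    linear_combination riccatiDenom k u₀ t * hkpq
  have hconst : ∀ f : ℝ → ℝ, (∀ t ∈ Ico 0 T, HasDerivWithinAt f 0 (Ico 0 T) t) →
      ∀ t ∈ Ico 0 T, f t = f 0 := fun f hf t ht => by
    have := eqOn_zero_of_linear_ode (w := fun t => f t - f 0) (u := fun _ => 0)
      continuousOn_const (fun t ht => by simpa using (hf t ht).sub_const (f 0)) (sub_self _) t ht
    exact sub_eq_zero.1 this
  intro t ht
  refine ⟨?_, ?_, by linear_combination hw t ht⟩
  · have := hconst (fun t => a t * riccatiDenom k u₀ t) (fun t ht => by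
      refine ((h t ht).2.1.mul (hφ t)).congr_deriv ?_
      linear_combination a t * hw t ht) t ht
    simpa using this
  · have := hconst (fun t => c t * riccatiDenom k u₀ t - 2 * q * riccatiInt k u₀ t) (fun t ht => by
      refine (((h t ht).2.2.mul (hφ t)).sub ((hΦ t).const_mul (2 * q))).congr_deriv ?_
      linear_combination c t * hw t ht) t ht
    simp at this
    linear_combination this

theorem growthRate_div_riccatiDenom {p q a₀ c₀ : ℝ} (hk : k ≠ 0) (hkpq : k ^ 2 = -4 * p * q)
    (hc₀ : 0 < c₀) (hu₀ : u₀ = growthRate p q a₀ c₀) {t : ℝ} (hφ : riccatiDenom k u₀ t ≠ 0) :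
    c₀ + 2 * q * riccatiInt k u₀ t ≠ 0 ∧
    growthRate p q (a₀ / riccatiDenom k u₀ t)
      ((c₀ + 2 * q * riccatiInt k u₀ t) / riccatiDenom k u₀ t) =
      (u₀ - k ^ 2 * riccatiInt k u₀ t) / riccatiDenom k u₀ t := by
  have hsq := riccatiDenom_sq (u₀ := u₀) hk t
  set φ := riccatiDenom k u₀ t
  set Φ := riccatiInt k u₀ t
  set b₀ := (1 + a₀ ^ 2) / c₀ with hb
  have hb₀ : b₀ * c₀ = 1 + a₀ ^ 2 := by rw [hb]; field_simp
  have hu : u₀ = p * c₀ - q * b₀ := hu₀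
  -- This is bc = 1 + a² for the explicit solution, multiplied by φ².
  have key : (c₀ + 2 * q * Φ) * (b₀ - 2 * p * Φ) = φ ^ 2 + a₀ ^ 2 := by
    linear_combination hb₀ - hsq + 2 * Φ * hu - Φ ^ 2 * hkpq
  have hpos : 0 < φ ^ 2 := by positivity
  have hne : c₀ + 2 * q * Φ ≠ 0 := by
    intro h0
    rw [h0, zero_mul] at key
    nlinarith [sq_nonneg a₀]
  refine ⟨hne, ?_⟩
  have h2 : (1 + (a₀ / φ) ^ 2) / ((c₀ + 2 * q * Φ) / φ) = (b₀ - 2 * p * Φ) / φ := by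
    field_simp
    linear_combination -key
  rw [growthRate, h2, hu, hkpq]
  ring

theorem isCoefficientSolution_div_riccatiDenom {p q a₀ c₀ : ℝ} (hk : k ≠ 0)
    (hkpq : k ^ 2 = -4 * p * q) (hc₀ : 0 < c₀) (hu₀ : u₀ = growthRate p q a₀ c₀) {I : Set ℝ}
    (hI : I.OrdConnected) (h0 : 0 ∈ I) (hφ : ∀ t ∈ I, 0 < riccatiDenom k u₀ t) :
    IsCoefficientSolution p q (fun t => a₀ / riccatiDenom k u₀ t)
      (fun t => (c₀ + 2 * q * riccatiInt k u₀ t) / riccatiDenom k u₀ t) I := by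
  have hφ' := fun t => (hasDerivAt_riccatiDenom (u₀ := u₀) hk t)
  have hΦ' := fun t => (hasDerivAt_riccatiInt (u₀ := u₀) hk t)
  -- The numerator has no zero where φ ≠ 0 and is positive at 0, so it cannot change sign on the
  -- interval.
  have hpos : ∀ t ∈ I, 0 < c₀ + 2 * q * riccatiInt k u₀ t := by
    intro t ht
    by_contra! hle
    have hcont : ContinuousOn (fun t => c₀ + 2 * q * riccatiInt k u₀ t) I := fun s _ =>
      (((hΦ' s).continuousAt.const_mul _).const_add _).continuousWithinAt
    obtain ⟨s, hs, hs0⟩ := hI.isPreconnected.intermediate_value ht h0 hcont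
      ⟨hle, by simpa using hc₀.le⟩
    exact (growthRate_div_riccatiDenom hk hkpq hc₀ hu₀ (hφ s hs).ne').1 hs0
  intro t ht
  have hne := (hφ t ht).ne'
  refine ⟨div_pos (hpos t ht) (hφ t ht), ?_, ?_⟩
  · refine ((hasDerivAt_const t a₀).div (hφ' t) hne).hasDerivWithinAt.congr_deriv ?_
    rw [(growthRate_div_riccatiDenom hk hkpq hc₀ hu₀ hne).2]
    field_simp
    ring
  · refine ((((hΦ' t).const_mul (2 * q)).const_add c₀).div (hφ' t)
      hne).hasDerivWithinAt.congr_deriv ?_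
    rw [(growthRate_div_riccatiDenom hk hkpq hc₀ hu₀ hne).2]
    field_simp
    ring

end Riccati

end TorsionFlow

namespace TorsionFlow

/-! ### Long-time behaviour and blow-up of the explicit solution. -/

section Asymptotics

variable {p q k u₀ a₀ c₀ : ℝ}

theorem neg_div_pos_of_mul_neg (hpq : p * q < 0) : 0 < -q / p := by
  have hp : p ≠ 0 := by rintro rfl; simp at hpq
  have : -q / p = -(p * q) / p ^ 2 := by field_simp
  rw [this]
  have : 0 < -(p * q) := by linarith
  positivity

theorem eq_sqrt_iff_of_mul_neg (hpq : p * q < 0) {c : ℝ} (hc : 0 < c) :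
    c = √(-q / p) ↔ p * c ^ 2 + q = 0 := by
  have hp : p ≠ 0 := by rintro rfl; simp at hpq
  rw [eq_comm, Real.sqrt_eq_iff_mul_self_eq (neg_div_pos_of_mul_neg hpq).le hc.le, ← pow_two,
    div_eq_iff hp]
  constructor <;> intro h <;> linarith

/-- The stationary points of the coefficients. -/
theorem stationary_iff (hpq : p * q < 0) {a c : ℝ} (hc : 0 < c) :
    (a * growthRate p q a c = 0 ∧ c * growthRate p q a c + 2 * q = 0) ↔
      a = 0 ∧ c = √(-q / p) := by
  have hq : q ≠ 0 := by rintro rfl; simp at hpq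
  have huc : c * growthRate p q a c = p * c ^ 2 - q * (1 + a ^ 2) := by
    rw [growthRate]; field_simp
  rw [eq_sqrt_iff_of_mul_neg hpq hc, huc]
  constructor
  · rintro ⟨h1, h2⟩
    have ha : a = 0 := by
      rcases mul_eq_zero.1 h1 with ha | hu
      · exact ha
      · rw [hu, mul_zero] at huc
        exact absurd (by linarith) hq
    subst ha
    exact ⟨rfl, by linarith⟩
  · rintro ⟨rfl, h⟩
    exact ⟨by simp, by linarith⟩

theorem riccatiDenom_eq_exp (t : ℝ) : riccatiDenom k u₀ t =
    ((1 + u₀ / k) - (u₀ / k - 1) * Real.exp (2 * k * t)) / (2 * Real.exp (k * t)) := by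
  have h2 : Real.exp (2 * k * t) = Real.exp (k * t) ^ 2 := by
    rw [← Real.exp_nat_mul]; push_cast; ring_nf
  rw [riccatiDenom, Real.cosh_eq, Real.sinh_eq, Real.exp_neg, h2]
  have := Real.exp_pos (k * t)
  generalize u₀ / k = m
  field_simp
  ring

/-- For t ≥ 0, kΦ differs from φ by a bounded term, so Φ/φ → 1/k once φ → ∞. -/
theorem riccatiInt_eq (hk : k ≠ 0) (t : ℝ) : k * riccatiInt k u₀ t =
    riccatiDenom k u₀ t + u₀ / k - (1 + u₀ / k) * Real.exp (-(k * t)) := by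
  rw [riccatiDenom, riccatiInt, Real.cosh_eq, Real.sinh_eq]
  field_simp
  ring

theorem half_exp_lt_riccatiDenom (hk : 0 < k) (hu₀ : u₀ ≤ 0) {t : ℝ} (ht : 0 ≤ t) :
    Real.exp (k * t) / 2 < riccatiDenom k u₀ t := by
  have h1 : u₀ / k * Real.sinh (k * t) ≤ 0 :=
    mul_nonpos_of_nonpos_of_nonneg (div_nonpos_of_nonpos_of_nonneg hu₀ hk.le)
      (Real.sinh_nonneg_iff.2 (by positivity))
  have h2 := Real.exp_pos (-(k * t))
  rw [riccatiDenom, Real.cosh_eq]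
  linarith

theorem tendsto_riccatiDenom_atTop (hk : 0 < k) (hu₀ : u₀ ≤ 0) :
    Tendsto (riccatiDenom k u₀) atTop atTop := by
  have h1 : Tendsto (fun t => Real.exp (k * t) / 2) atTop atTop :=
    (Real.tendsto_exp_atTop.comp (tendsto_id.const_mul_atTop hk)).atTop_div_const two_pos
  refine tendsto_atTop_mono' _ ?_ h1
  filter_upwards [eventually_ge_atTop 0] with t ht using (half_exp_lt_riccatiDenom hk hu₀ ht).le

theorem tendsto_div_riccatiDenom (hk : 0 < k) (hu₀ : u₀ ≤ 0) (r s : ℝ) :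
    Tendsto (fun t => (r + s * riccatiInt k u₀ t) / riccatiDenom k u₀ t) atTop (𝓝 (s / k)) := by
  have hφ := tendsto_riccatiDenom_atTop hk hu₀
  have hexp : Tendsto (fun t => Real.exp (-(k * t))) atTop (𝓝 0) :=
    Real.tendsto_exp_neg_atTop_nhds_zero.comp (tendsto_id.const_mul_atTop hk)
  have h1 := (((hexp.const_mul (1 + u₀ / k)).const_sub (u₀ / k)).const_mul (s / k)).const_add r
  have h2 := (h1.div_atTop hφ).const_add (s / k)
  rw [add_zero] at h2
  refine h2.congr' ?_
  filter_upwards [hφ.eventually_gt_atTop 0] with t ht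
  have h3 := riccatiInt_eq (u₀ := u₀) hk.ne' t
  have h4 : riccatiInt k u₀ t = (riccatiDenom k u₀ t + u₀ / k -
      (1 + u₀ / k) * Real.exp (-(k * t))) / k := by
    rw [← h3]; field_simp
  rw [h4]
  generalize u₀ / k = m
  field_simp
  ring

theorem tendsto_homJ {M : Type*} [TopologicalSpace M] [ChartedSpace E3 M]
    (σ : Fin 3 → OneForm M ℝ) (X : Fin 3 → VField M) {l : Filter ℝ} {a c : ℝ → ℝ} {A B : ℝ}
    (ha : Tendsto a l (𝓝 A)) (hc : Tendsto c l (𝓝 B)) (hB : B ≠ 0) (x : M)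
    (v : TangentSpace (𝓡 3) x) :
    Tendsto (fun t => homJ σ X (a t) (c t) x v) l (𝓝 (homJ σ X A B x v)) := by
  have key : ∀ e₁ e₂ : E3, ∀ s₁ s₂ : ℝ, Tendsto
      (fun s => s₁ • (a s • e₁ + c s • e₂) - s₂ • (((1 + a s ^ 2) / c s) • e₁ + a s • e₂)) l
      (𝓝 (s₁ • (A • e₁ + B • e₂) - s₂ • (((1 + A ^ 2) / B) • e₁ + A • e₂))) := fun e₁ e₂ s₁ s₂ =>
    (((ha.smul_const e₁).add (hc.smul_const e₂)).const_smul s₁).sub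
      ((((((ha.pow 2).const_add 1).div hc hB).smul_const e₁).add (ha.smul_const e₂)).const_smul s₂)
  exact key (X 1 x) (X 2 x) (σ 1 x v) (σ 2 x v)

/-- In the repelling case the growth rate exceeds its stationary value away from the stationary
point. -/
theorem lt_growthRate (hp : 0 < p) (hq : q < 0) (hkpq : k ^ 2 = -4 * p * q)
    (hc₀ : 0 < c₀) (hne : ¬(a₀ = 0 ∧ c₀ = √(-q / p))) : k < growthRate p q a₀ c₀ := by
  have hpq : p * q < 0 := mul_neg_of_pos_of_neg hp hq
  set b₀ := (1 + a₀ ^ 2) / c₀ with hb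
  have hb₀ : b₀ * c₀ = 1 + a₀ ^ 2 := by rw [hb]; field_simp
  have hbpos : 0 < b₀ := by positivity
  have hu : growthRate p q a₀ c₀ = p * c₀ - q * b₀ := rfl
  -- By b₀c₀ = 1 + a₀² the difference is a sum of two nonnegative terms, which vanish together only
  -- at the stationary point.
  have hsq : growthRate p q a₀ c₀ ^ 2 - k ^ 2 = (p * c₀ + q * b₀) ^ 2 + -4 * p * q * a₀ ^ 2 := by
    rw [hu]; linear_combination (-4 * p * q) * hb₀ - hkpq
  have hupos : 0 < growthRate p q a₀ c₀ := by
    rw [hu]; nlinarith [mul_pos hp hc₀]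
  refine lt_of_pow_lt_pow_left₀ 2 hupos.le ?_
  by_contra! hle
  refine hne ?_
  have h1 : 0 ≤ -4 * p * q * a₀ ^ 2 := by nlinarith [sq_nonneg a₀]
  have h2 := sq_nonneg (p * c₀ + q * b₀)
  have h3 : -4 * p * q * a₀ ^ 2 = 0 := by linarith
  have h4 : (p * c₀ + q * b₀) ^ 2 = 0 := by linarith
  have ha : a₀ = 0 := by
    have : (-4 * p * q) ≠ 0 := by nlinarith
    simpa [hp.ne', hq.ne] using h3
  have h5 : p * c₀ + q * b₀ = 0 := by simpa using h4
  refine ⟨ha, (eq_sqrt_iff_of_mul_neg hpq hc₀).2 ?_⟩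
  subst ha
  linear_combination c₀ * h5 - q * hb₀

/-- The first zero of `riccatiDenom k u₀` if `k < u₀`. -/
noncomputable def blowUpTime (k u₀ : ℝ) : ℝ := Real.log ((u₀ / k + 1) / (u₀ / k - 1)) / (2 * k)

variable (hk : 0 < k) (hku : k < u₀)
include hk hku

theorem blowUpTime_pos : 0 < blowUpTime k u₀ := by
  have hm : 1 < u₀ / k := (one_lt_div hk).2 hku
  refine div_pos (Real.log_pos ?_) (by positivity)
  rw [one_lt_div (by linarith)]
  linarith

theorem exp_blowUpTime :
    Real.exp (2 * k * blowUpTime k u₀) = (u₀ / k + 1) / (u₀ / k - 1) := by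
  have hm : 1 < u₀ / k := (one_lt_div hk).2 hku
  rw [blowUpTime, mul_div_cancel₀ _ (by positivity), Real.exp_log]
  exact div_pos (by linarith) (by linarith)

theorem riccatiDenom_blowUpTime : riccatiDenom k u₀ (blowUpTime k u₀) = 0 := by
  have hm : 1 < u₀ / k := (one_lt_div hk).2 hku
  have : u₀ / k - 1 ≠ 0 := by linarith
  rw [riccatiDenom_eq_exp, exp_blowUpTime hk hku, mul_div_cancel₀ _ this]
  simp [add_comm]

theorem riccatiDenom_pos_of_lt_blowUpTime {t : ℝ} (ht : t < blowUpTime k u₀) :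
    0 < riccatiDenom k u₀ t := by
  have hm : 1 < u₀ / k := (one_lt_div hk).2 hku
  have h1 : Real.exp (2 * k * t) < (u₀ / k + 1) / (u₀ / k - 1) := by
    rw [← exp_blowUpTime hk hku]
    exact Real.exp_lt_exp.2 (mul_lt_mul_of_pos_left ht (by positivity))
  rw [lt_div_iff₀ (by linarith)] at h1
  rw [riccatiDenom_eq_exp]
  exact div_pos (by linarith) (by positivity)

/-- No solution of the coefficient equations goes beyond the blow-up time. -/
theorem IsCoefficientSolution.le_blowUpTime {a c : ℝ → ℝ} {T : ℝ}
    (h : IsCoefficientSolution p q a c (Ico 0 T)) (ha : a 0 = a₀) (hc : c 0 = c₀)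
    (hkpq : k ^ 2 = -4 * p * q) (hu₀ : u₀ = growthRate p q a₀ c₀) : T ≤ blowUpTime k u₀ := by
  by_contra! hlt
  -- At a zero of φ, the formula for uφ gives k²Φ = u₀, and the first integral then gives u₀² = k²,
  -- contrary to k < u₀.
  have h1 := (h.mul_riccatiDenom ha hc hk.ne' hkpq hu₀ _ ⟨(blowUpTime_pos hk hku).le, hlt⟩).2.2
  have h2 := riccatiDenom_sq (u₀ := u₀) hk.ne' (blowUpTime k u₀)
  rw [riccatiDenom_blowUpTime hk hku] at h1 h2
  have h3 : k ^ 2 = u₀ ^ 2 := by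
    linear_combination (-k ^ 2) * h2 + (u₀ - k ^ 2 * riccatiInt k u₀ (blowUpTime k u₀)) * h1
  nlinarith

/-- The first integral reads (uφ)² = u₀² - k² + k²φ², so u grows at least like a positive constant
over φ; and u ≤ (p - q)(|a| + |c| + |b|). -/
theorem tendsto_coefficients_blowUp {a c : ℝ → ℝ} (hp : 0 < p) (hq : q < 0)
    (h : IsCoefficientSolution p q a c (Ico 0 (blowUpTime k u₀))) (ha : a 0 = a₀) (hc : c 0 = c₀)
    (hkpq : k ^ 2 = -4 * p * q) (hu₀ : u₀ = growthRate p q a₀ c₀) :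
    Tendsto (fun t => |a t| + |c t| + |(1 + a t ^ 2) / c t|) (𝓝[<] blowUpTime k u₀) atTop := by
  set T := blowUpTime k u₀ with hT
  have hd : 0 < √(u₀ ^ 2 - k ^ 2) := Real.sqrt_pos.2 (by nlinarith)
  have hmem : ∀ᶠ t in 𝓝[<] T, t ∈ Ico 0 T := Ico_mem_nhdsLT (blowUpTime_pos hk hku)
  have hlim : Tendsto (riccatiDenom k u₀) (𝓝[<] T) (𝓝[>] 0) := by
    refine tendsto_nhdsWithin_iff.2 ⟨?_, ?_⟩
    · rw [← riccatiDenom_blowUpTime hk hku]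
      exact (hasDerivAt_riccatiDenom hk.ne' T).continuousAt.tendsto.mono_left nhdsWithin_le_nhds
    · filter_upwards [hmem] with t ht using riccatiDenom_pos_of_lt_blowUpTime hk hku ht.2
  have hK : 0 < p - q := by linarith
  refine tendsto_atTop_mono' _ ?_
    ((tendsto_inv_nhdsGT_zero.comp hlim).const_mul_atTop (div_pos hd hK))
  filter_upwards [hmem] with t ht
  have hφ := riccatiDenom_pos_of_lt_blowUpTime hk hku ht.2
  have hu := (h.mul_riccatiDenom ha hc hk.ne' hkpq hu₀ t ht).2.2
  have hsq := riccatiDenom_sq (u₀ := u₀) hk.ne' t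
  have hct := (h t ht).1
  have hb : 0 < (1 + a t ^ 2) / c t := by positivity
  have hupos : 0 < growthRate p q (a t) (c t) := by
    rw [growthRate]; nlinarith [mul_pos hp hct]
  have h1 : √(u₀ ^ 2 - k ^ 2) ≤ growthRate p q (a t) (c t) * riccatiDenom k u₀ t := by
    refine Real.sqrt_le_iff.2 ⟨by positivity, ?_⟩
    rw [hu]
    nlinarith [mul_nonneg (sq_nonneg k) (sq_nonneg (riccatiDenom k u₀ t))]
  have h2 : growthRate p q (a t) (c t) ≤
      (p - q) * (|a t| + |c t| + |(1 + a t ^ 2) / c t|) := by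
    rw [abs_of_pos hct, abs_of_pos hb, growthRate]
    nlinarith [mul_nonneg hK.le (abs_nonneg (a t)), mul_pos hp hb, mul_pos (neg_pos.2 hq) hct]
  rw [Function.comp_apply, ← div_eq_mul_inv, div_div, div_le_iff₀ (by positivity)]
  calc _ ≤ _ := h1
    _ ≤ _ := mul_le_mul_of_nonneg_right h2 hφ.le
    _ = _ := by ring

end Asymptotics

/-- The entries a, c and -b are continuous functions of J in the frame, so a limit of J would keep
their absolute values bounded. -/
theorem not_tendsto_homJ {M : Type*} [TopologicalSpace M] [ChartedSpace E3 M]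
    {σ : Fin 3 → OneForm M ℝ} {X : Fin 3 → VField M} {C : Fin 3 → Fin 3 → Fin 3 → ℝ}
    (hM : IsHomogeneousContact σ X C (σ 0)) {l : Filter ℝ} [l.NeBot] {a c : ℝ → ℝ}
    (h : Tendsto (fun t => |a t| + |c t| + |(1 + a t ^ 2) / c t|) l atTop) (x : M) :
    ¬ ∃ L : TangentSpace (𝓡 3) x → TangentSpace (𝓡 3) x, ∀ v,
      Tendsto (fun t => homJ σ X (a t) (c t) x v) l (𝓝 (L v)) := by
  rintro ⟨L, hL⟩
  have hσ : ∀ i v, Tendsto (fun t => |σ i x (homJ σ X (a t) (c t) x v)|) l (𝓝 |σ i x (L v)|) :=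
    fun i v => (((σ i x).continuous.tendsto _).comp (hL v)).abs
  refine not_tendsto_nhds_of_tendsto_atTop h _
    ((((hσ 1 (X 1 x)).add (hσ 2 (X 1 x))).add (hσ 1 (X 2 x))).congr fun t => ?_)
  obtain ⟨h1, h2, h3⟩ := coframe_homJ_frame_one hM (a t) (c t) x
  rw [h1, h2, h3, abs_neg]

end TorsionFlow

/-! ### The attracting case, the repelling case and the fixed point. -/

theorem mainTheorem6 {M : Type*} [TopologicalSpace M] [T2Space M] [SecondCountableTopology M]
    [Nonempty M] [ChartedSpace TorsionFlow.E3 M] [IsManifold (𝓡 3) ∞ M]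
    [MeasurableSpace M] [BorelSpace M]
    (σ : Fin 3 → TorsionFlow.OneForm M ℝ) (X : Fin 3 → TorsionFlow.VField M)
    (C : Fin 3 → Fin 3 → Fin 3 → ℝ)
    (hM : TorsionFlow.IsHomogeneousContact σ X C (σ 0))
    (hC : TorsionFlow.IsNormalizedBasis C)
    (a₀ c₀ : ℝ) (hc₀ : 0 < c₀) :
    -- the attracting case
    (0 < C 2 0 1 → C 1 0 2 < 0 →
      -- the unique torsion-free structure
      (∀ a c : ℝ, 0 < c →
        (TorsionFlow.IsTorsionFree σ X a c ↔ a = 0 ∧ c = √(-C 2 0 1 / C 1 0 2))) ∧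
      -- the flow exists for all times, is unique, and converges to that structure
      ∃ a c : ℝ → ℝ,
        TorsionFlow.IsHomogeneousFlow σ X a₀ c₀ a c (Ici 0) ∧
        (∀ T > 0, ∀ a' c' : ℝ → ℝ, TorsionFlow.IsHomogeneousFlow σ X a₀ c₀ a' c' (Ico 0 T) →
          EqOn a' a (Ico 0 T) ∧ EqOn c' c (Ico 0 T)) ∧
        Tendsto a atTop (𝓝 0) ∧ Tendsto c atTop (𝓝 √(-C 2 0 1 / C 1 0 2)) ∧
        ∀ x v, Tendsto (fun t => TorsionFlow.homJ σ X (a t) (c t) x v) atTop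
          (𝓝 (TorsionFlow.homJ σ X 0 √(-C 2 0 1 / C 1 0 2) x v))) ∧
    -- the repelling case
    (C 2 0 1 < 0 → 0 < C 1 0 2 →
      -- away from the fixed point: blow-up in finite time, no convergence
      (¬(a₀ = 0 ∧ c₀ = √(-C 2 0 1 / C 1 0 2)) →
        ∃ T > 0, ∃ a c : ℝ → ℝ,
          TorsionFlow.IsHomogeneousFlow σ X a₀ c₀ a c (Ico 0 T) ∧
          (∀ T' > 0, ∀ a' c' : ℝ → ℝ,
            TorsionFlow.IsHomogeneousFlow σ X a₀ c₀ a' c' (Ico 0 T') →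
            T' ≤ T ∧ EqOn a' a (Ico 0 T') ∧ EqOn c' c (Ico 0 T')) ∧
          -- the coefficients of `J` in the fixed frame are unbounded
          Tendsto (fun t => |a t| + |c t| + |(1 + a t ^ 2) / c t|) (𝓝[<] T) atTop ∧
          ∀ x, ¬ ∃ L : TangentSpace (𝓡 3) x → TangentSpace (𝓡 3) x, ∀ v,
            Tendsto (fun t => TorsionFlow.homJ σ X (a t) (c t) x v) (𝓝[<] T) (𝓝 (L v))) ∧
      -- at the fixed point: the torsion vanishes and the flow is constant
      (a₀ = 0 → c₀ = √(-C 2 0 1 / C 1 0 2) →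
        TorsionFlow.IsTorsionFree σ X a₀ c₀ ∧
        TorsionFlow.IsHomogeneousFlow σ X a₀ c₀ (fun _ => a₀) (fun _ => c₀) (Ici 0) ∧
        ∀ T > 0, ∀ a c : ℝ → ℝ, TorsionFlow.IsHomogeneousFlow σ X a₀ c₀ a c (Ico 0 T) →
          ∀ t ∈ Ico 0 T, a t = a₀ ∧ c t = c₀)) := by
  set p := C 1 0 2 with hp
  set q := C 2 0 1 with hq
  set k := √(-4 * p * q) with hk_def
  set u₀ := TorsionFlow.growthRate p q a₀ c₀ with hu₀
  have hk_of : p * q < 0 → 0 < k ∧ k ^ 2 = -4 * p * q := fun hpq => by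
    have h : 0 < -4 * p * q := by linarith
    exact ⟨Real.sqrt_pos.2 h, Real.sq_sqrt h.le⟩
  have hfree : p * q < 0 → ∀ a c : ℝ, 0 < c →
      (TorsionFlow.IsTorsionFree σ X a c ↔ a = 0 ∧ c = √(-q / p)) := fun hpq a c hc =>
    (TorsionFlow.isTorsionFree_iff hM hC a hc).trans (TorsionFlow.stationary_iff hpq hc)
  -- a solution is determined where the denominator of the explicit formula is positive
  have hunique : p * q < 0 → ∀ T : ℝ, (∀ t ∈ Ico 0 T, 0 < TorsionFlow.riccatiDenom k u₀ t) →
      ∀ a c : ℝ → ℝ, TorsionFlow.IsHomogeneousFlow σ X a₀ c₀ a c (Ico 0 T) →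
      EqOn a (fun t => a₀ / TorsionFlow.riccatiDenom k u₀ t) (Ico 0 T) ∧
      EqOn c (fun t => (c₀ + 2 * q * TorsionFlow.riccatiInt k u₀ t) /
        TorsionFlow.riccatiDenom k u₀ t) (Ico 0 T) := by
    intro hpq T hφ a c h
    obtain ⟨hk, hkpq⟩ := hk_of hpq
    have h1 := (h.isCoefficientSolution hM hC).mul_riccatiDenom h.initial.1 h.initial.2 hk.ne'
      hkpq hu₀
    exact ⟨fun t ht => eq_div_of_mul_eq (hφ t ht).ne' (h1 t ht).1,
      fun t ht => eq_div_of_mul_eq (hφ t ht).ne' (h1 t ht).2.1⟩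
  refine ⟨fun hqpos hpneg => ?_, fun hqneg hppos => ⟨fun hne => ?_, ?_⟩⟩
  · have hpq : p * q < 0 := mul_neg_of_neg_of_pos hpneg hqpos
    obtain ⟨hk, hkpq⟩ := hk_of hpq
    have hu₀neg : u₀ ≤ 0 := by
      have h1 : 0 < (1 + a₀ ^ 2) / c₀ := by positivity
      rw [hu₀, TorsionFlow.growthRate]
      nlinarith [mul_pos hqpos h1]
    have hφ : ∀ t ∈ Ici (0 : ℝ), 0 < TorsionFlow.riccatiDenom k u₀ t := fun t ht =>
      lt_trans (by positivity) (TorsionFlow.half_exp_lt_riccatiDenom hk hu₀neg ht)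
    -- From k² = -4pq, the positive number 2q/k solves pc² + q = 0.
    have hlim : √(-q / p) = 2 * q / k := by
      refine (((TorsionFlow.eq_sqrt_iff_of_mul_neg hpq (by positivity)).2 ?_)).symm
      field_simp
      linear_combination q * hkpq
    have hsqrt : 0 < √(-q / p) := by rw [hlim]; positivity
    have ha : Tendsto (fun t => a₀ / TorsionFlow.riccatiDenom k u₀ t) atTop (𝓝 0) :=
      tendsto_const_nhds.div_atTop (TorsionFlow.tendsto_riccatiDenom_atTop hk hu₀neg)
    have hc : Tendsto (fun t => (c₀ + 2 * q * TorsionFlow.riccatiInt k u₀ t) /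
        TorsionFlow.riccatiDenom k u₀ t) atTop (𝓝 √(-q / p)) := by
      rw [hlim]
      exact TorsionFlow.tendsto_div_riccatiDenom hk hu₀neg c₀ (2 * q)
    exact ⟨hfree hpq, _, _,
      (TorsionFlow.isCoefficientSolution_div_riccatiDenom hk.ne' hkpq hc₀ hu₀ ordConnected_Ici
        self_mem_Ici hφ).isHomogeneousFlow hM hC (by simp) (by simp),
      fun T _ => hunique hpq T fun t ht => hφ t ht.1, ha, hc,
      TorsionFlow.tendsto_homJ σ X ha hc hsqrt.ne'⟩
  · have hpq : p * q < 0 := mul_neg_of_pos_of_neg hppos hqneg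
    obtain ⟨hk, hkpq⟩ := hk_of hpq
    have hku : k < u₀ := TorsionFlow.lt_growthRate hppos hqneg hkpq hc₀ hne
    have hT := TorsionFlow.blowUpTime_pos hk hku
    have hφ : ∀ t < TorsionFlow.blowUpTime k u₀, 0 < TorsionFlow.riccatiDenom k u₀ t :=
      fun t => TorsionFlow.riccatiDenom_pos_of_lt_blowUpTime hk hku
    have hsol := TorsionFlow.isCoefficientSolution_div_riccatiDenom hk.ne' hkpq hc₀ hu₀
      (ordConnected_Ico (a := 0) (b := TorsionFlow.blowUpTime k u₀)) ⟨le_rfl, hT⟩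
      fun t ht => hφ t ht.2
    have hblow := TorsionFlow.tendsto_coefficients_blowUp hk hku hppos hqneg hsol (by simp)
      (by simp) hkpq hu₀
    refine ⟨_, hT, _, _, hsol.isHomogeneousFlow hM hC (by simp) (by simp), ?_, hblow,
      TorsionFlow.not_tendsto_homJ hM hblow⟩
    intro T' _ a' c' h
    -- The bound on T' comes first: only then is φ known to be positive on all of [0, T').
    have hle := (h.isCoefficientSolution hM hC).le_blowUpTime hk hku h.initial.1 h.initial.2
      hkpq hu₀
    exact ⟨hle, hunique hpq T' (fun t ht => hφ t (ht.2.trans_le hle)) a' c' h⟩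
  · intro ha₀ hc₀'
    have hpq : p * q < 0 := mul_neg_of_pos_of_neg hppos hqneg
    obtain ⟨hk, hkpq⟩ := hk_of hpq
    obtain ⟨h1, h2⟩ := (TorsionFlow.stationary_iff hpq hc₀).2 ⟨ha₀, hc₀'⟩
    have hconst : ∀ I, TorsionFlow.IsHomogeneousFlow σ X a₀ c₀ (fun _ => a₀) (fun _ => c₀) I :=
      fun I => TorsionFlow.IsCoefficientSolution.isHomogeneousFlow hM hC (fun t _ =>
        ⟨hc₀, by rw [h1]; exact hasDerivWithinAt_const .., by
          rw [h2]; exact hasDerivWithinAt_const ..⟩) rfl rfl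
    refine ⟨(hfree hpq a₀ c₀ hc₀).2 ⟨ha₀, hc₀'⟩, hconst _, ?_⟩
    intro T _ a c h t ht
    -- Stationarity gives c₀u₀ = -2q > 0, and pc₀² = -q turns its square into c₀²k².
    have hu₀k : u₀ = k := by
      have h3 : c₀ * u₀ = -2 * q := by linarith
      have h4 := (TorsionFlow.eq_sqrt_iff_of_mul_neg hpq hc₀).1 hc₀'
      have hupos : 0 < u₀ := pos_of_mul_pos_right (by rw [h3]; linarith) hc₀.le
      refine (pow_left_inj₀ hupos.le hk.le two_ne_zero).1 ?_
      rw [hkpq]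
      refine mul_left_cancel₀ (pow_ne_zero 2 hc₀.ne') ?_
      linear_combination (c₀ * u₀ - 2 * q) * h3 + 4 * q * h4
    have hφ : ∀ t ∈ Ico 0 T, 0 < TorsionFlow.riccatiDenom k u₀ t := fun t _ => by
      rw [TorsionFlow.riccatiDenom, hu₀k, div_self hk.ne', one_mul, Real.cosh_sub_sinh]
      exact Real.exp_pos _
    -- Both the given solution and the constant one agree with the explicit formula, hence with each
    -- other.
    obtain ⟨e1, e2⟩ := hunique hpq T hφ a c h
    obtain ⟨e3, e4⟩ := hunique hpq T hφ _ _ (hconst _)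
    exact ⟨(e1 ht).trans (e3 ht).symm, (e2 ht).trans (e4 ht).symm⟩
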